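/- Let $m,N$ be nonnegative integers and let $G=\Lambda_m\mathbb R^N$ be the additive group of $m$-vectors, with the Euclidean norm $|\cdot|$ for which the $m$-vectors $\mathbf e_{i_1}\wedge\dots\wedge\mathbf e_{i_m}$ ($i_1<\dots<i_m$) are orthonormal. For an integer $k\ge 0$, let $\mathcal P_k(G)$ be the group of polyhedral $k$-chains in $\mathbb R^N$ with coefficients in $G$: it is the quotient of the group of formal finite sums $\sum_i g_i\sigma_i$ ($g_i\in G$, $\sigma_i$ an oriented $k$-dimensional compact convex polyhedron in $\mathbb R^N$) by the subgroup generated by the relations $g\sigma\equiv g\sigma'+g\sigma''$ whenever $\sigma',\sigma''$ are obtained from $\sigma$ by cutting it along a hyperplane, and $g\sigma\equiv -g\tilde\sigma$ whenever $\tilde\sigma$ is $\sigma$ with the reversed orientation. The class of $\sum_i g_i\sigma_i$ is written $\sum_i g_i[\sigma_i]$. Let $\partial:\mathcal P_{k+1}(G)\to\mathcal P_k(G)$ be the boundary homomorphism, which sends $g[\tau]$ to $\sum_j g[\sigma_j]$, where the $\sigma_j$ are the $k$-dimensional faces of $\tau$ with the induced orientations. The mass of a polyhedral chain is $\mathrm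 M\bigl(\sum_i g_i[\sigma_i]\bigr)=\sum_i|g_i|\,\mathcal H^k(\sigma_i)$ for any representation with non-overlapping $\sigma_i$, and the flat norm of $A\in\mathcal P_m(G)$ is $$\mathcal F(A)=\inf_{Q\in\mathcal P_{m+1}(G)}\bigl(\mathrm M(A+\partial Q)+\mathrm M(Q)\bigr).$$ Let $\mathcal F_m(G)$, the group of flat $m$-chains, be the metric completion of $\mathcal P_m(G)$ with respect to the flat norm; $\mathcal F$ extends to it by continuity. The mass $\mathrm M(A)\in[0,\infty]$ of a flat chain $A$ is the infimum of $\liminf_i \mathrm M(A_i)$ over all sequences of polyhedral chains $A_i$ that converge to $A$ in the flat norm. For an oriented $m$-dimensional polyhedron $\sigma$, let $\eta(\sigma)$ be the corresponding simple unit $m$-vector, and let $\Phi:\mathcal P_m(G)\to\mathbb R$ be the homomorphism $$\Phi\Bigl(\sum_i g_i[\sigma_i]\Bigr)=\sum_i (g_i\cdot\eta(\sigma_i))\,\mathcal H^m(\sigma_i).$$ Then: 1. $\Phi(\partial Q)=0$ for every $Q\in\mathcal P_{m+1}(G)$. 2. $\Phi(A)\le\mathcal F(A)\le \mathrm M(A)$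 for every $A\in\mathcal P_m(G)$. 3. $\Phi$ extends to a continuous additive homomorphism $\Phi:\mathcal F_m(G)\to\mathbb R$ such that $\Phi(A)\le\mathcal F(A)\le \mathrm M(A)$ for every flat $m$-chain $A$. -/

import Mathlib

open scoped MeasureTheory

namespace FlatChains

/-- Euclidean space `ℝ^N`. -/
abbrev Space (N : ℕ) : Type := EuclideanSpace ℝ (Fin N)

/-- The space of `m`-vectors of `ℝ^N` (with Mathlib's Euclidean structure, for which the vectors
`e_{i_1} ∧ ⋯ ∧ e_{i_m}`, `i_1 < ⋯ < i_m`, are orthonormal). -/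
abbrev MVector (N m : ℕ) : Type := ⋀[ℝ]^m (Space N)

/-- An oriented `m`-dimensional polyhedron in `ℝ^N`: a nonempty bounded intersection of finitely
many closed half-spaces, together with a unit simple `m`-vector `η = ± b_1 ∧ ⋯ ∧ b_m`, where
`b` is an orthonormal basis of the direction of its affine span (which is therefore
`m`-dimensional). -/
@[ext]
structure OrientedPolyhedron (N m : ℕ) where
  carrier : Set (Space N)
  nonempty : carrier.Nonempty
  isBounded : Bornology.IsBounded carrier
  isPolyhedral : ∃ H : Finset (Space N × ℝ), carrier = {x | ∀ h ∈ H, inner ℝ h.1 x ≤ h.2}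
  η : MVector N m
  isOrientation : ∃ b : Fin m → Space N, Orthonormal ℝ b ∧
    Submodule.span ℝ (Set.range b) = vectorSpan ℝ carrier ∧
    (η = exteriorPower.ιMulti ℝ m b ∨ η = -exteriorPower.ιMulti ℝ m b)

variable {N m : ℕ}

namespace OrientedPolyhedron

/-- The same polyhedron with the opposite orientation. -/
def reverse (σ : OrientedPolyhedron N m) : OrientedPolyhedron N m where
  carrier := σ.carrier
  nonempty := σ.nonempty
  isBounded := σ.isBounded
  isPolyhedral := σ.isPolyhedral
  η := -σ.η
  isOrientation := by
    obtain ⟨b, h1, h2, h3⟩ := σ.isOrientation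
    refine ⟨b, h1, h2, ?_⟩
    rcases h3 with h | h
    · exact Or.inr (by rw [h])
    · exact Or.inl (by rw [h, neg_neg])

/-- The `m`-dimensional Hausdorff measure of the polyhedron. -/
noncomputable def area (σ : OrientedPolyhedron N m) : ℝ := (μHE[m] σ.carrier).toReal

/-- The hyperplane `{x | ⟪n, x⟫ = c}` meets the relative interior of `σ`, and cuts `σ` into
`σ₁` and `σ₂`, which have the same orientation as `σ`. -/
def IsSubdivision (σ σ₁ σ₂ : OrientedPolyhedron N m) : Prop :=
  ∃ (n : Space N) (c : ℝ), (∃ x ∈ σ.carrier, inner ℝ n x < c) ∧ (∃ x ∈ σ.carrier, c < inner ℝ n x) ∧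
    σ₁.carrier = {x ∈ σ.carrier | inner ℝ n x ≤ c} ∧
    σ₂.carrier = {x ∈ σ.carrier | c ≤ inner ℝ n x} ∧ σ₁.η = σ.η ∧ σ₂.η = σ.η

/-- `F` is an `m`-dimensional face of the `(m+1)`-dimensional polyhedron `τ`, with the orientation
induced by that of `τ`: if `ν` is the unit normal to `F` that is tangent to `τ` and points out of
`τ`, then `η(τ) = η(F) ∧ ν`. -/
def IsFace (τ : OrientedPolyhedron N (m + 1)) (F : OrientedPolyhedron N m) : Prop :=
  ∃ (ν : Space N) (c : ℝ), ‖ν‖ = 1 ∧ ν ∈ vectorSpan ℝ τ.carrier ∧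
    (∀ x ∈ τ.carrier, inner ℝ ν x ≤ c) ∧ F.carrier = {x ∈ τ.carrier | inner ℝ ν x = c} ∧
    (τ.η : ExteriorAlgebra ℝ (Space N)) = F.η * ExteriorAlgebra.ι ℝ ν

lemma convex (σ : OrientedPolyhedron N m) : Convex ℝ σ.carrier := by
  obtain ⟨H, hH⟩ := σ.isPolyhedral
  rw [hH]
  intro x hx y hy a b ha hb hab h hh
  have h1 := hx h hh
  have h2 := hy h hh
  rw [inner_add_right, inner_smul_right, inner_smul_right]
  calc a * inner ℝ h.1 x + b * inner ℝ h.1 y ≤ a * h.2 + b * h.2 := by gcongr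
    _ = h.2 := by rw [← add_mul, hab, one_mul]

lemma isClosed (σ : OrientedPolyhedron N m) : IsClosed σ.carrier := by
  obtain ⟨H, hH⟩ := σ.isPolyhedral
  have : σ.carrier = ⋂ h ∈ H, {x | inner ℝ h.1 x ≤ h.2} := by
    rw [hH]; ext x; simp
  rw [this]
  exact isClosed_biInter fun h _ => isClosed_le (by fun_prop) (by fun_prop)

lemma finrank_vectorSpan (σ : OrientedPolyhedron N m) :
    Module.finrank ℝ (vectorSpan ℝ σ.carrier) = m := by
  obtain ⟨b, h1, h2, -⟩ := σ.isOrientation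
  rw [← h2, finrank_span_eq_card h1.linearIndependent, Fintype.card_fin]

lemma area_nonneg (σ : OrientedPolyhedron N m) : 0 ≤ σ.area := ENNReal.toReal_nonneg

lemma measure_ne_top (σ : OrientedPolyhedron N m) : μHE[m] σ.carrier ≠ ⊤ := by
  set A := affineSpan ℝ σ.carrier with hA
  obtain ⟨p, hp⟩ := σ.nonempty
  have hpA : p ∈ A := subset_affineSpan ℝ _ hp
  have : Nonempty A := ⟨⟨p, hpA⟩⟩
  have hr : Module.finrank ℝ A.direction = m := by
    rw [hA, direction_affineSpan, σ.finrank_vectorSpan]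
  have himg : σ.carrier = Subtype.val '' ((Subtype.val : A → Space N) ⁻¹' σ.carrier) := by
    ext x
    constructor
    · exact fun hx => ⟨⟨x, subset_affineSpan ℝ _ hx⟩, hx, rfl⟩
    · rintro ⟨y, hy, rfl⟩
      exact hy
  rw [himg, AffineSubspace.euclideanHausdorffMeasure_coe_image]
  generalize hs : (Subtype.val : A → Space N) ⁻¹' σ.carrier = s
  have hsb : Bornology.IsBounded s := by
    rw [← hs]
    exact isometry_subtype_coe.antilipschitz.isBounded_preimage σ.isBounded
  rw [← hr, EuclideanGeometry.euclideanHausdorffMeasure_eq (⟨p, hpA⟩ : A)]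
  have hm : MeasurableEmbedding (IsometryEquiv.vaddConst (⟨p, hpA⟩ : A)) :=
    (IsometryEquiv.vaddConst (⟨p, hpA⟩ : A)).toHomeomorph.measurableEmbedding
  rw [hm.map_apply]
  apply ne_of_lt
  apply Bornology.IsBounded.measure_lt_top
  exact (IsometryEquiv.vaddConst (⟨p, hpA⟩ : A)).isometry.antilipschitz.isBounded_preimage hsb

/-- A hyperplane that does not contain a polyhedron meets it in a null set. -/
lemma measure_inter_hyperplane (σ : OrientedPolyhedron N m) (n : Space N) (c : ℝ)
    (h : ∃ x ∈ σ.carrier, inner ℝ n x ≠ c) :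
    μHE[m] {x ∈ σ.carrier | inner ℝ n x = c} = 0 := by
  set C := {x ∈ σ.carrier | inner ℝ n x = c} with hC
  rw [MeasureTheory.Measure.euclideanHausdorffMeasure_def, MeasureTheory.Measure.smul_apply]
  suffices MeasureTheory.Measure.hausdorffMeasure (m : ℝ) C = 0 by rw [this, smul_zero]
  rcases C.eq_empty_or_nonempty with he | ⟨y, hy⟩
  · rw [he]; simp
  have hconv : Convex ℝ C := by
    apply σ.convex.inter
    exact convex_hyperplane (f := fun x => inner ℝ n x)
      ⟨fun x y => inner_add_right _ _ _, fun a x => by simp [inner_smul_right]⟩ c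
  have := Real.Convex.dimH_eq_finrank_vectorSpan hconv ⟨y, hy⟩
  have hlt : vectorSpan ℝ C < vectorSpan ℝ σ.carrier := by
    refine lt_of_le_of_ne (vectorSpan_mono ℝ (fun x hx => hx.1)) fun he => ?_
    obtain ⟨x, hx, hxc⟩ := h
    have h1 : x - y ∈ vectorSpan ℝ C := by
      rw [he]; exact vsub_mem_vectorSpan ℝ hx hy.1
    have h2 : vectorSpan ℝ C ≤ LinearMap.ker (innerₛₗ ℝ n) := by
      rw [vectorSpan, Submodule.span_le]
      rintro _ ⟨u, hu, v, hv, rfl⟩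
      simp [inner_sub_right, hu.2, hv.2]
    have h3 : inner ℝ n (x - y) = 0 := by simpa using h2 h1
    rw [inner_sub_right, hy.2] at h3
    exact hxc (by linarith)
  have hl := Submodule.finrank_lt_finrank_of_lt hlt
  rw [σ.finrank_vectorSpan] at hl
  exact hausdorffMeasure_of_dimH_lt (d := (m : NNReal)) (by rw [this]; exact_mod_cast hl)

lemma area_of_isSubdivision {σ σ₁ σ₂ : OrientedPolyhedron N m} (h : IsSubdivision σ σ₁ σ₂) :
    σ.area = σ₁.area + σ₂.area := by
  obtain ⟨n, c, ⟨x, hx, hxc⟩, -, h1, h2, -, -⟩ := h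
  have hU : σ.carrier = σ₁.carrier ∪ σ₂.carrier := by
    ext y
    rw [h1, h2]
    constructor
    · intro hy
      rcases le_total (inner ℝ n y) c with h | h
      · exact Or.inl ⟨hy, h⟩
      · exact Or.inr ⟨hy, h⟩
    · rintro (h | h) <;> exact h.1
  have h0 : μHE[m] (σ₁.carrier ∩ σ₂.carrier) = 0 := by
    refine MeasureTheory.measure_mono_null ?_
      (σ.measure_inter_hyperplane n c ⟨x, hx, hxc.ne⟩)
    rw [h1, h2]
    rintro y ⟨hy1, hy2⟩
    exact ⟨hy1.1, le_antisymm hy1.2 hy2.2⟩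
  rw [area, area, area, ← ENNReal.toReal_add σ₁.measure_ne_top σ₂.measure_ne_top, hU,
    MeasureTheory.measure_union₀ σ₂.isClosed.measurableSet.nullMeasurableSet h0]

lemma norm_ιMulti {b : Fin m → Space N} (hb : Orthonormal ℝ b) :
    ‖exteriorPower.ιMulti ℝ m b‖ = 1 := by
  have h : ‖exteriorPower.ιMulti ℝ m b‖ ^ 2 = 1 := by
    rw [← real_inner_self_eq_norm_sq, exteriorPower.inner_ιMulti_self,
      Matrix.gram_eq_one_iff_orthonormal.2 hb, Matrix.det_one]
  nlinarith [norm_nonneg (exteriorPower.ιMulti ℝ m b)]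

lemma eq_or_eq_neg {V : Submodule ℝ (Space N)} {b b' : Fin m → Space N}
    (hb : Orthonormal ℝ b) (hb' : Orthonormal ℝ b')
    (h : Submodule.span ℝ (Set.range b) = V) (h' : Submodule.span ℝ (Set.range b') = V) :
    exteriorPower.ιMulti ℝ m b' = exteriorPower.ιMulti ℝ m b ∨
      exteriorPower.ιMulti ℝ m b' = -exteriorPower.ιMulti ℝ m b := by
  have hm : ∀ i, b i ∈ V := fun i => h ▸ Submodule.subset_span ⟨i, rfl⟩
  have hm' : ∀ i, b' i ∈ V := fun i => h' ▸ Submodule.subset_span ⟨i, rfl⟩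
  have hV : Module.finrank ℝ V = m := by
    rw [← h, finrank_span_eq_card hb.linearIndependent, Fintype.card_fin]
  have h1 : Module.finrank ℝ (⋀[ℝ]^m V) = 1 := by
    rw [exteriorPower.finrank_eq, hV, Nat.choose_self]
  have hx : exteriorPower.ιMulti ℝ m b =
      exteriorPower.map m V.subtype (exteriorPower.ιMulti ℝ m fun i => (⟨b i, hm i⟩ : V)) := by
    rw [exteriorPower.map_apply_ιMulti]; rfl
  have hy : exteriorPower.ιMulti ℝ m b' =
      exteriorPower.map m V.subtype (exteriorPower.ιMulti ℝ m fun i => (⟨b' i, hm' i⟩ : V)) := by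
    rw [exteriorPower.map_apply_ιMulti]; rfl
  have hx0 : (exteriorPower.ιMulti ℝ m fun i => (⟨b i, hm i⟩ : V)) ≠ 0 := by
    intro h0
    have := norm_ιMulti hb
    rw [hx, h0, map_zero, norm_zero] at this
    exact zero_ne_one this
  obtain ⟨c, hc⟩ := exists_smul_eq_of_finrank_eq_one h1 hx0
    (exteriorPower.ιMulti ℝ m fun i => (⟨b' i, hm' i⟩ : V))
  have hcc : exteriorPower.ιMulti ℝ m b' = c • exteriorPower.ιMulti ℝ m b := by
    rw [hy, ← hc, map_smul, ← hx]
  have hn : |c| = 1 := by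
    have := norm_ιMulti hb'
    rwa [hcc, norm_smul, norm_ιMulti hb, mul_one, Real.norm_eq_abs] at this
  rcases (abs_eq zero_le_one).1 hn with rfl | rfl
  · left; rw [hcc, one_smul]
  · right; rw [hcc]; exact neg_one_smul ℝ (exteriorPower.ιMulti ℝ m b)

lemma norm_η (σ : OrientedPolyhedron N m) : ‖σ.η‖ = 1 := by
  obtain ⟨b, h1, -, h | h⟩ := σ.isOrientation
  · rw [h, norm_ιMulti h1]
  · rw [h, norm_neg, norm_ιMulti h1]

lemma η_eq_or_eq_neg {σ τ : OrientedPolyhedron N m}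
    (h : vectorSpan ℝ σ.carrier = vectorSpan ℝ τ.carrier) : τ.η = σ.η ∨ τ.η = -σ.η := by
  obtain ⟨b, h1, h2, h3⟩ := σ.isOrientation
  obtain ⟨b', h1', h2', h3'⟩ := τ.isOrientation
  have := eq_or_eq_neg h1 h1' (h2.trans h) h2'
  rcases h3 with h3 | h3 <;> rcases h3' with h3' | h3' <;> rcases this with h4 | h4 <;>
    simp [h3, h3', h4]

lemma eq_or_eq_reverse {σ τ : OrientedPolyhedron N m} (h : σ.carrier = τ.carrier) :
    τ = σ ∨ τ = σ.reverse := by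
  rcases η_eq_or_eq_neg (σ := σ) (τ := τ) (by rw [h]) with h' | h'
  · exact Or.inl (OrientedPolyhedron.ext h.symm h')
  · exact Or.inr (OrientedPolyhedron.ext h.symm h')


/-! Cutting by a half-space. -/

lemma exists_segment_le {n x y : Space N} {c : ℝ} (hx : inner ℝ n x < c) :
    ∃ t : ℝ, 0 < t ∧ t ≤ 1 ∧ inner ℝ n (x + t • (y - x)) ≤ c := by
  rcases le_or_gt (inner ℝ n y) c with h | h
  · exact ⟨1, one_pos, le_rfl, by simpa using h⟩
  · have hd : 0 < inner ℝ n y - inner ℝ n x := by linarith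
    refine ⟨(c - inner ℝ n x) / (inner ℝ n y - inner ℝ n x), div_pos (by linarith) hd,
      (div_le_one hd).2 (by linarith), ?_⟩
    rw [inner_add_right, inner_smul_right, inner_sub_right, div_mul_cancel₀ _ hd.ne']
    linarith

lemma vectorSpan_cut {S : Set (Space N)} (hS : Convex ℝ S) {n : Space N} {c : ℝ}
    (h : ∃ x ∈ S, inner ℝ n x < c) :
    vectorSpan ℝ {x ∈ S | inner ℝ n x ≤ c} = vectorSpan ℝ S := by
  apply le_antisymm (vectorSpan_mono ℝ fun x hx => hx.1)
  obtain ⟨x, hx, hxc⟩ := h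
  rw [vectorSpan_eq_span_vsub_set_right ℝ hx, Submodule.span_le]
  rintro _ ⟨y, hy, rfl⟩
  obtain ⟨t, ht, ht1, htc⟩ := exists_segment_le (y := y) hxc
  have hz : x + t • (y - x) ∈ {x ∈ S | inner ℝ n x ≤ c} :=
    ⟨hS.add_smul_sub_mem hx hy ⟨ht.le, ht1⟩, htc⟩
  have := vsub_mem_vectorSpan ℝ hz (show x ∈ {x ∈ S | inner ℝ n x ≤ c} from ⟨hx, hxc.le⟩)
  rw [vsub_eq_sub, add_sub_cancel_left] at this
  have h2 := Submodule.smul_mem _ t⁻¹ this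
  rwa [smul_smul, inv_mul_cancel₀ ht.ne', one_smul] at h2

/-- The part of a polyhedron in the closed half-space `{⟪n, x⟫ ≤ c}`, if the polyhedron meets the
corresponding open half-space. -/
def cut (σ : OrientedPolyhedron N m) (n : Space N) (c : ℝ)
    (h : ∃ x ∈ σ.carrier, inner ℝ n x < c) : OrientedPolyhedron N m where
  carrier := {x ∈ σ.carrier | inner ℝ n x ≤ c}
  nonempty := let ⟨x, hx, hxc⟩ := h; ⟨x, hx, hxc.le⟩
  isBounded := σ.isBounded.subset fun x hx => hx.1
  isPolyhedral := by
    classical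
    obtain ⟨H, hH⟩ := σ.isPolyhedral
    refine ⟨insert (n, c) H, ?_⟩
    ext x
    simp [hH, and_comm]
  η := σ.η
  isOrientation := by
    rw [vectorSpan_cut σ.convex h]
    exact σ.isOrientation

lemma isSubdivision_cut (σ : OrientedPolyhedron N m) {n : Space N} {c : ℝ}
    (h : ∃ x ∈ σ.carrier, inner ℝ n x < c) (h' : ∃ x ∈ σ.carrier, inner ℝ (-n) x < -c) :
    IsSubdivision σ (σ.cut n c h) (σ.cut (-n) (-c) h') :=
  ⟨n, c, h, by simpa using h', rfl, by simp [cut], rfl, rfl⟩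

end OrientedPolyhedron

open OrientedPolyhedron

/-- The group of formal polyhedral `m`-chains `∑ g_i σ_i` with coefficients in `G`. -/
abbrev FormalChain (N m : ℕ) (G : Type*) [AddCommGroup G] : Type _ :=
  OrientedPolyhedron N m →₀ G

/-- The relations `g σ ≡ g σ₁ + g σ₂` if `σ₁, σ₂` subdivide `σ`, and `g σ ≡ -g σ̃` if `σ̃` is `σ`
with the reversed orientation. -/
noncomputable def chainRelations (N m : ℕ) (G : Type*) [AddCommGroup G] : AddSubgroup (FormalChain N m G) :=
  AddSubgroup.closure
    ({x | ∃ (g : G) (σ σ₁ σ₂ : OrientedPolyhedron N m), IsSubdivision σ σ₁ σ₂ ∧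
        x = Finsupp.single σ g - (Finsupp.single σ₁ g + Finsupp.single σ₂ g)} ∪
      {x | ∃ (g : G) (σ : OrientedPolyhedron N m),
        x = Finsupp.single σ g + Finsupp.single σ.reverse g})

/-- The group `𝒫_m(G)` of polyhedral `m`-chains in `ℝ^N` with coefficients in `G`. -/
def PolyhedralChain (N m : ℕ) (G : Type*) [AddCommGroup G] : Type _ :=
  FormalChain N m G ⧸ chainRelations N m G

noncomputable instance (N m : ℕ) (G : Type*) [AddCommGroup G] :
    AddCommGroup (PolyhedralChain N m G) :=
  inferInstanceAs (AddCommGroup (FormalChain N m G ⧸ chainRelations N m G))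

/-- The class of a formal chain. -/
noncomputable def toChain {N m : ℕ} {G : Type*} [AddCommGroup G] :
    FormalChain N m G →+ PolyhedralChain N m G :=
  QuotientAddGroup.mk' (chainRelations N m G)

section Lift

variable {G : Type*} [AddCommGroup G] {K : Type*} [AddCommGroup K]

lemma toChain_surjective : Function.Surjective (toChain : FormalChain N m G →+ _) :=
  QuotientAddGroup.mk'_surjective _

lemma toChain_subdivision {σ σ₁ σ₂ : OrientedPolyhedron N m} (h : IsSubdivision σ σ₁ σ₂) (g : G) :
    toChain (Finsupp.single σ g) =
      toChain (Finsupp.single σ₁ g) + toChain (Finsupp.single σ₂ g) := by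
  rw [← map_add, ← sub_eq_zero, ← map_sub]
  exact (QuotientAddGroup.eq_zero_iff _).2
    (AddSubgroup.subset_closure (Or.inl ⟨g, σ, σ₁, σ₂, h, rfl⟩))

lemma toChain_reverse (σ : OrientedPolyhedron N m) (g : G) :
    toChain (Finsupp.single σ.reverse g) = -toChain (Finsupp.single σ g) := by
  rw [eq_neg_iff_add_eq_zero, ← map_add, add_comm]
  exact (QuotientAddGroup.eq_zero_iff _).2 (AddSubgroup.subset_closure (Or.inr ⟨g, σ, rfl⟩))

/-- A homomorphism on formal chains that respects the relations descends to polyhedral chains. -/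
noncomputable def chainLift (f : FormalChain N m G →+ K)
    (h1 : ∀ (g : G) (σ σ₁ σ₂ : OrientedPolyhedron N m), IsSubdivision σ σ₁ σ₂ →
      f (Finsupp.single σ g) = f (Finsupp.single σ₁ g) + f (Finsupp.single σ₂ g))
    (h2 : ∀ (g : G) (σ : OrientedPolyhedron N m),
      f (Finsupp.single σ.reverse g) = -f (Finsupp.single σ g)) :
    PolyhedralChain N m G →+ K :=
  QuotientAddGroup.lift (chainRelations N m G) f <| by
    rw [chainRelations, AddSubgroup.closure_le]
    rintro x (⟨g, σ, σ₁, σ₂, h, rfl⟩ | ⟨g, σ, rfl⟩)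
    · simp [h1 g σ σ₁ σ₂ h]
    · simp [h2 g σ]

lemma chainLift_toChain (f : FormalChain N m G →+ K) (h1 h2) (c : FormalChain N m G) :
    chainLift f h1 h2 (toChain c) = f c := rfl

end Lift

section Mass

variable {G : Type*} [NormedAddCommGroup G]

/-- `∑ |g_i| H^m(σ_i)`. -/
noncomputable def weight (c : FormalChain N m G) : ℝ := c.sum fun σ g => ‖g‖ * σ.area

/-- The polyhedra of the formal chain do not overlap: distinct ones meet in sets of `m`-dimensional
measure zero. -/
def IsNonoverlapping (c : FormalChain N m G) : Prop :=
  ∀ σ ∈ c.support, ∀ τ ∈ c.support, σ ≠ τ → μHE[m] (σ.carrier ∩ τ.carrier) = 0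

/-- The mass of a polyhedral chain: `∑ |g_i| H^m(σ_i)` for a representation `∑ g_i [σ_i]` by
non-overlapping polyhedra. (Such representations exist, and all give the same value.) -/
noncomputable def mass (A : PolyhedralChain N m G) : ℝ :=
  sInf {w | ∃ c : FormalChain N m G, IsNonoverlapping c ∧ toChain c = A ∧ w = weight c}

lemma weight_nonneg (c : FormalChain N m G) : 0 ≤ weight c :=
  Finset.sum_nonneg fun σ _ => mul_nonneg (norm_nonneg _) σ.area_nonneg

lemma weight_zero : weight (0 : FormalChain N m G) = 0 := Finsupp.sum_zero_index

lemma weight_single (σ : OrientedPolyhedron N m) (g : G) :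
    weight (Finsupp.single σ g) = ‖g‖ * σ.area := Finsupp.sum_single_index (by simp)

lemma weight_add_le (c d : FormalChain N m G) : weight (c + d) ≤ weight c + weight d := by
  classical
  have hs : ∀ e : FormalChain N m G, e.support ⊆ c.support ∪ d.support →
      weight e = ∑ σ ∈ c.support ∪ d.support, ‖e σ‖ * σ.area := fun e he =>
    Finsupp.sum_of_support_subset _ he _ (by simp)
  rw [hs _ Finsupp.support_add, hs c Finset.subset_union_left, hs d Finset.subset_union_right,
    ← Finset.sum_add_distrib]
  refine Finset.sum_le_sum fun σ _ => ?_
  rw [← add_mul]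
  exact mul_le_mul_of_nonneg_right (norm_add_le _ _) σ.area_nonneg

lemma weight_neg (c : FormalChain N m G) : weight (-c) = weight c := by
  simp [weight, Finsupp.sum]

lemma weight_sum_le {ι : Type*} (s : Finset ι) (f : ι → FormalChain N m G) :
    weight (∑ i ∈ s, f i) ≤ ∑ i ∈ s, weight (f i) := by
  classical
  induction s using Finset.induction_on with
  | empty => simp [weight_zero]
  | insert a s ha ih =>
    rw [Finset.sum_insert ha, Finset.sum_insert ha]
    exact (weight_add_le _ _).trans (by linarith)

/-- A set that is an intersection of half-spaces taken from a finite list. -/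
def IsCell (L : Finset (Space N × ℝ)) (s : Set (Space N)) : Prop :=
  ∃ T ⊆ L, s = {x | ∀ h ∈ T, inner ℝ h.1 x ≤ h.2}

/-- A set that lies on one side of a hyperplane. -/
def OneSided (p : Space N × ℝ) (s : Set (Space N)) : Prop :=
  (∀ x ∈ s, inner ℝ p.1 x ≤ p.2) ∨ (∀ x ∈ s, p.2 ≤ inner ℝ p.1 x)

lemma exists_split_single {L : Finset (Space N × ℝ)} (hL : ∀ p ∈ L, -p ∈ L) {p : Space N × ℝ}
    (hp : p ∈ L) (σ : OrientedPolyhedron N m) (hσ : IsCell L σ.carrier) (g : G) :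
    ∃ d : FormalChain N m G, toChain d = toChain (Finsupp.single σ g) ∧
      weight d ≤ ‖g‖ * σ.area ∧ ∀ τ ∈ d.support, IsCell L τ.carrier ∧ τ.carrier ⊆ σ.carrier ∧
        OneSided p τ.carrier := by
  classical
  by_cases h1 : ∃ x ∈ σ.carrier, inner ℝ p.1 x < p.2
  · by_cases h2 : ∃ x ∈ σ.carrier, inner ℝ (-p.1) x < -p.2
    · have hs := σ.isSubdivision_cut h1 h2
      refine ⟨Finsupp.single (σ.cut p.1 p.2 h1) g + Finsupp.single (σ.cut (-p.1) (-p.2) h2) g,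
        ?_, ?_, ?_⟩
      · rw [map_add, toChain_subdivision hs]
      · refine (weight_add_le _ _).trans ?_
        rw [weight_single, weight_single, area_of_isSubdivision hs, mul_add]
      · obtain ⟨T, hT, hTσ⟩ := hσ
        intro τ hτ
        have hτ' : τ = σ.cut p.1 p.2 h1 ∨ τ = σ.cut (-p.1) (-p.2) h2 := by
          have := Finsupp.support_add hτ
          rw [Finset.mem_union] at this
          exact this.imp (fun h => Finset.mem_singleton.1 (Finsupp.support_single_subset h))
            (fun h => Finset.mem_singleton.1 (Finsupp.support_single_subset h))
        rcases hτ' with rfl | rfl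
        · refine ⟨⟨insert p T, Finset.insert_subset hp hT, ?_⟩, fun x hx => hx.1,
            Or.inl fun x hx => hx.2⟩
          ext x
          simp [cut, hTσ, and_comm]
        · refine ⟨⟨insert (-p) T, Finset.insert_subset (hL p hp) hT, ?_⟩, fun x hx => hx.1,
            Or.inr fun x hx => by simpa using hx.2⟩
          ext x
          simp [cut, hTσ, and_comm]
    · refine ⟨Finsupp.single σ g, rfl, (weight_single σ g).le, fun τ hτ => ?_⟩
      obtain rfl := Finset.mem_singleton.1 (Finsupp.support_single_subset hτ)
      refine ⟨hσ, subset_rfl, Or.inl fun x hx => ?_⟩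
      by_contra hc
      exact h2 ⟨x, hx, by simpa using hc⟩
  · refine ⟨Finsupp.single σ g, rfl, (weight_single σ g).le, fun τ hτ => ?_⟩
    obtain rfl := Finset.mem_singleton.1 (Finsupp.support_single_subset hτ)
    refine ⟨hσ, subset_rfl, Or.inr fun x hx => ?_⟩
    by_contra hc
    exact h1 ⟨x, hx, by simpa using hc⟩

lemma exists_split {L : Finset (Space N × ℝ)} (hL : ∀ p ∈ L, -p ∈ L) {p : Space N × ℝ}
    (hp : p ∈ L) (c : FormalChain N m G) (hc : ∀ σ ∈ c.support, IsCell L σ.carrier) :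
    ∃ d : FormalChain N m G, toChain d = toChain c ∧ weight d ≤ weight c ∧
      ∀ τ ∈ d.support, IsCell L τ.carrier ∧ OneSided p τ.carrier ∧
        ∃ σ ∈ c.support, τ.carrier ⊆ σ.carrier := by
  classical
  have h : ∀ σ : OrientedPolyhedron N m, ∃ d : FormalChain N m G, σ ∈ c.support →
      toChain d = toChain (Finsupp.single σ (c σ)) ∧
      weight d ≤ ‖c σ‖ * σ.area ∧ ∀ τ ∈ d.support, IsCell L τ.carrier ∧ τ.carrier ⊆ σ.carrier ∧
        OneSided p τ.carrier := fun σ => by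
    by_cases hσ : σ ∈ c.support
    · obtain ⟨d, hd⟩ := exists_split_single hL hp σ (hc σ hσ) (c σ)
      exact ⟨d, fun _ => hd⟩
    · exact ⟨0, fun h => absurd h hσ⟩
  choose d hd using h
  refine ⟨∑ σ ∈ c.support, d σ, ?_, ?_, ?_⟩
  · conv_rhs => rw [← Finsupp.sum_single c]
    rw [Finsupp.sum, map_sum, map_sum]
    exact Finset.sum_congr rfl fun σ hσ => (hd σ hσ).1
  · exact (weight_sum_le _ _).trans (Finset.sum_le_sum fun σ hσ => (hd σ hσ).2.1)
  · intro τ hτ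
    obtain ⟨σ, hσ, hτσ⟩ := Finset.mem_biUnion.1 (Finsupp.support_finsetSum hτ)
    obtain ⟨h1, h2, h3⟩ := (hd σ hσ).2.2 τ hτσ
    exact ⟨h1, h3, σ, hσ, h2⟩

lemma exists_split_all {L : Finset (Space N × ℝ)} (hL : ∀ p ∈ L, -p ∈ L)
    (c : FormalChain N m G) (hc : ∀ σ ∈ c.support, IsCell L σ.carrier)
    (T : Finset (Space N × ℝ)) (hT : T ⊆ L) :
    ∃ d : FormalChain N m G, toChain d = toChain c ∧ weight d ≤ weight c ∧
      ∀ τ ∈ d.support, IsCell L τ.carrier ∧ ∀ p ∈ T, OneSided p τ.carrier := by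
  classical
  induction T using Finset.induction_on with
  | empty => exact ⟨c, rfl, le_rfl, fun τ hτ => ⟨hc τ hτ, by simp⟩⟩
  | insert a s ha ih =>
    obtain ⟨d, h1, h2, h3⟩ := ih ((Finset.subset_insert _ _).trans hT)
    obtain ⟨e, k1, k2, k3⟩ := exists_split hL (hT (Finset.mem_insert_self a s)) d
      fun σ hσ => (h3 σ hσ).1
    refine ⟨e, k1.trans h1, k2.trans h2, fun τ hτ => ⟨(k3 τ hτ).1, fun p hp => ?_⟩⟩
    obtain ⟨σ, hσ, hτσ⟩ := (k3 τ hτ).2.2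
    rcases Finset.mem_insert.1 hp with rfl | hp
    · exact (k3 τ hτ).2.1
    · exact ((h3 σ hσ).2 p hp).imp (fun h x hx => h x (hτσ hx)) (fun h x hx => h x (hτσ hx))

lemma subset_or_null {L : Finset (Space N × ℝ)} {σ τ : OrientedPolyhedron N m}
    (hτ : IsCell L τ.carrier) (hσL : ∀ p ∈ L, OneSided p σ.carrier) :
    σ.carrier ⊆ τ.carrier ∨ μHE[m] (σ.carrier ∩ τ.carrier) = 0 := by
  obtain ⟨T, hT, hTτ⟩ := hτ
  by_contra! hcon
  obtain ⟨hsub, hnull⟩ := hcon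
  apply hsub
  rw [hTτ]
  intro x hx p hp
  rcases hσL p (hT hp) with h | h
  · exact h x hx
  · by_contra hlt
    apply hnull
    refine MeasureTheory.measure_mono_null ?_
      (σ.measure_inter_hyperplane p.1 p.2 ⟨x, hx, fun he => hlt he.le⟩)
    rintro y ⟨hy1, hy2⟩
    rw [hTτ] at hy2
    exact ⟨hy1, le_antisymm (hy2 p hp) (h y hy1)⟩

/-- A polyhedron chosen among those with the same carrier. -/
noncomputable def standard (σ : OrientedPolyhedron N m) : OrientedPolyhedron N m :=
  Classical.choose (p := fun τ : OrientedPolyhedron N m => τ.carrier = σ.carrier) ⟨σ, rfl⟩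

lemma standard_carrier (σ : OrientedPolyhedron N m) : (standard σ).carrier = σ.carrier :=
  Classical.choose_spec (p := fun τ : OrientedPolyhedron N m => τ.carrier = σ.carrier) ⟨σ, rfl⟩

lemma standard_congr {σ τ : OrientedPolyhedron N m} (h : σ.carrier = τ.carrier) :
    standard σ = standard τ := by
  unfold standard
  simp only [h]

lemma exists_merge (c : FormalChain N m G)
    (hc : ∀ σ ∈ c.support, ∀ τ ∈ c.support,
      σ.carrier = τ.carrier ∨ μHE[m] (σ.carrier ∩ τ.carrier) = 0) :
    ∃ d : FormalChain N m G, toChain d = toChain c ∧ weight d ≤ weight c ∧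
      IsNonoverlapping d := by
  classical
  have h : ∀ σ : OrientedPolyhedron N m, ∃ g : G, ‖g‖ = ‖c σ‖ ∧
      toChain (Finsupp.single (standard σ) g) = toChain (Finsupp.single σ (c σ)) := fun σ => by
    rcases eq_or_eq_reverse (standard_carrier σ).symm with h | h
    · exact ⟨c σ, rfl, by rw [h]⟩
    · refine ⟨-c σ, norm_neg _, ?_⟩
      rw [h, toChain_reverse, Finsupp.single_neg, map_neg, neg_neg]
  choose g hg1 hg2 using h
  refine ⟨∑ σ ∈ c.support, Finsupp.single (standard σ) (g σ), ?_, ?_, ?_⟩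
  · conv_rhs => rw [← Finsupp.sum_single c]
    rw [Finsupp.sum, map_sum, map_sum]
    exact Finset.sum_congr rfl fun σ _ => hg2 σ
  · refine (weight_sum_le _ _).trans (Finset.sum_le_sum fun σ _ => ?_)
    rw [weight_single, hg1]; exact (congrArg (fun s => ‖c σ‖ * (μHE[m] s).toReal) (standard_carrier σ)).le
  · intro σ hσ τ hτ hne
    obtain ⟨σ', hσ', h1⟩ := Finset.mem_biUnion.1 (Finsupp.support_finsetSum hσ)
    obtain ⟨τ', hτ', h2⟩ := Finset.mem_biUnion.1 (Finsupp.support_finsetSum hτ)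
    obtain rfl := Finset.mem_singleton.1 (Finsupp.support_single_subset h1)
    obtain rfl := Finset.mem_singleton.1 (Finsupp.support_single_subset h2)
    rw [standard_carrier, standard_carrier]
    exact (hc σ' hσ' τ' hτ').resolve_left fun h => hne (standard_congr h)

/-- Every polyhedral chain has non-overlapping representations. -/
lemma exists_nonoverlapping (c : FormalChain N m G) :
    ∃ d : FormalChain N m G, toChain d = toChain c ∧ weight d ≤ weight c ∧
      IsNonoverlapping d := by
  classical
  choose H hH using fun σ : OrientedPolyhedron N m => σ.isPolyhedral
  set L₀ := c.support.biUnion H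
  set L := L₀ ∪ L₀.image Neg.neg with hLdef
  have hL : ∀ p ∈ L, -p ∈ L := by
    intro p hp
    rw [hLdef, Finset.mem_union, Finset.mem_image] at hp ⊢
    rcases hp with hp | ⟨q, hq, rfl⟩
    · exact Or.inr ⟨p, hp, rfl⟩
    · exact Or.inl (by rwa [neg_neg])
  obtain ⟨d, h1, h2, h3⟩ := exists_split_all hL c (fun σ hσ => ⟨H σ,
    (Finset.subset_biUnion_of_mem H hσ).trans Finset.subset_union_left, hH σ⟩) L subset_rfl
  obtain ⟨e, k1, k2, k3⟩ := exists_merge d fun σ hσ τ hτ => by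
    by_cases h0 : μHE[m] (σ.carrier ∩ τ.carrier) = 0
    · exact Or.inr h0
    · left
      apply subset_antisymm
      · exact (subset_or_null (h3 τ hτ).1 (h3 σ hσ).2).resolve_right h0
      · exact (subset_or_null (h3 σ hσ).1 (h3 τ hτ).2).resolve_right
          (by rwa [Set.inter_comm])
  exact ⟨e, k1.trans h1, k2.trans h2, k3⟩

lemma mass_nonneg (A : PolyhedralChain N m G) : 0 ≤ mass A :=
  Real.sInf_nonneg (by rintro w ⟨c, -, -, rfl⟩; exact weight_nonneg c)

lemma mass_le_weight (c : FormalChain N m G) : mass (toChain c) ≤ weight c := by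
  obtain ⟨d, h1, h2, h3⟩ := exists_nonoverlapping c
  refine le_trans (csInf_le ⟨0, ?_⟩ ⟨d, h3, h1, rfl⟩) h2
  rintro w ⟨c, -, -, rfl⟩
  exact weight_nonneg c

lemma exists_weight_lt (A : PolyhedralChain N m G) {ε : ℝ} (hε : 0 < ε) :
    ∃ c : FormalChain N m G, toChain c = A ∧ weight c < mass A + ε := by
  obtain ⟨c, rfl⟩ := toChain_surjective A
  obtain ⟨d, h1, -, h3⟩ := exists_nonoverlapping c
  obtain ⟨w, ⟨e, -, k2, rfl⟩, hw⟩ := exists_lt_of_csInf_lt (s := {w | ∃ e : FormalChain N m G,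
    IsNonoverlapping e ∧ toChain e = toChain c ∧ w = weight e}) ⟨_, d, h3, h1, rfl⟩
    (lt_add_of_pos_right (mass (toChain c)) hε)
  exact ⟨e, k2, hw⟩

lemma mass_zero : mass (0 : PolyhedralChain N m G) = 0 := by
  apply le_antisymm _ (mass_nonneg _)
  have := mass_le_weight (0 : FormalChain N m G)
  rwa [map_zero, weight_zero] at this

lemma mass_add_le (A B : PolyhedralChain N m G) : mass (A + B) ≤ mass A + mass B := by
  apply le_of_forall_pos_le_add
  intro ε hε
  obtain ⟨c, rfl, hc⟩ := exists_weight_lt A (half_pos hε)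
  obtain ⟨d, rfl, hd⟩ := exists_weight_lt B (half_pos hε)
  rw [← map_add]
  linarith [mass_le_weight (c + d), weight_add_le c d]

lemma mass_neg (A : PolyhedralChain N m G) : mass (-A) = mass A := by
  have key : ∀ A : PolyhedralChain N m G, mass (-A) ≤ mass A := fun A => by
    apply le_of_forall_pos_le_add
    intro ε hε
    obtain ⟨c, rfl, hc⟩ := exists_weight_lt A hε
    rw [← map_neg]
    linarith [mass_le_weight (-c), weight_neg c]
  apply le_antisymm (key A)
  simpa using key (-A)

end Mass


/-! The boundary operator. -/

section Faces

lemma inner_eq_zero_of_mem_vectorSpan {S : Set (Space N)} {n : Space N} {c : ℝ}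
    (h : ∀ x ∈ S, inner ℝ n x = c) {v : Space N} (hv : v ∈ vectorSpan ℝ S) : inner ℝ n v = 0 := by
  have h2 : vectorSpan ℝ S ≤ LinearMap.ker (innerₛₗ ℝ n) := by
    rw [vectorSpan, Submodule.span_le]
    rintro _ ⟨u, hu, v, hv, rfl⟩
    simp [inner_sub_right, h u hu, h v hv]
  simpa using h2 hv

lemma normal_unique {V W : Submodule ℝ (Space N)} (hWV : W ≤ V)
    (hf : Module.finrank ℝ V = Module.finrank ℝ W + 1) {ν ν' : Space N} (hν : ‖ν‖ = 1)
    (hν' : ‖ν'‖ = 1) (h : ν ∈ V) (h' : ν' ∈ V) (hW : ∀ w ∈ W, inner ℝ ν w = 0)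
    (hW' : ∀ w ∈ W, inner ℝ ν' w = 0) : ν' = ν ∨ ν' = -ν := by
  have h1 : Module.finrank ℝ (Wᗮ ⊓ V : Submodule ℝ (Space N)) = 1 := by
    have := Submodule.finrank_add_inf_finrank_orthogonal hWV
    omega
  have m1 : ν ∈ Wᗮ ⊓ V := ⟨(Submodule.mem_orthogonal' _ _).2 hW, h⟩
  have m2 : ν' ∈ Wᗮ ⊓ V := ⟨(Submodule.mem_orthogonal' _ _).2 hW', h'⟩
  obtain ⟨a, ha⟩ := exists_smul_eq_of_finrank_eq_one h1
    (x := (⟨ν, m1⟩ : (Wᗮ ⊓ V : Submodule ℝ (Space N))))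
    (by
      intro h0
      have : ν = 0 := congrArg Subtype.val h0
      rw [this, norm_zero] at hν
      exact zero_ne_one hν) ⟨ν', m2⟩
  have ha' : a • ν = ν' := congrArg Subtype.val ha
  have hn : |a| = 1 := by
    rwa [← ha', norm_smul, hν, mul_one, Real.norm_eq_abs] at hν'
  rcases (abs_eq zero_le_one).1 hn with rfl | rfl
  · left; rw [← ha', one_smul]
  · right; rw [← ha', neg_one_smul]

lemma mem_of_sub_mem_vectorSpan {S F : Set (Space N)} {ν : Space N} {a : ℝ}
    (hF : F = {x ∈ S | inner ℝ ν x = a}) {p x : Space N} (hp : p ∈ F) (hx : x ∈ S)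
    (h : x - p ∈ vectorSpan ℝ F) : x ∈ F := by
  have h0 := inner_eq_zero_of_mem_vectorSpan (n := ν) (c := a) (S := F)
    (fun y hy => by rw [hF] at hy; exact hy.2) h
  rw [hF] at hp ⊢
  rw [inner_sub_right, hp.2] at h0
  exact ⟨hx, by linarith⟩

lemma exists_crossing {n x y : Space N} {c : ℝ} (hy : inner ℝ n y ≤ c) (hx : c < inner ℝ n x) :
    ∃ t : ℝ, 0 ≤ t ∧ t < 1 ∧ inner ℝ n (y + t • (x - y)) = c := by
  have hd : 0 < inner ℝ n x - inner ℝ n y := by linarith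
  refine ⟨(c - inner ℝ n y) / (inner ℝ n x - inner ℝ n y), div_nonneg (by linarith) hd.le,
    (div_lt_one hd).2 (by linarith), ?_⟩
  rw [inner_add_right, inner_smul_right, inner_sub_right, div_mul_cancel₀ _ hd.ne']
  linarith

lemma isPolyhedral_inter_hyperplane (σ : OrientedPolyhedron N m) (n : Space N) (c : ℝ) :
    ∃ H : Finset (Space N × ℝ),
      {x ∈ σ.carrier | inner ℝ n x = c} = {x | ∀ h ∈ H, inner ℝ h.1 x ≤ h.2} := by
  classical
  obtain ⟨H, hH⟩ := σ.isPolyhedral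
  refine ⟨insert (n, c) (insert (-n, -c) H), ?_⟩
  ext x
  simp only [hH, Set.mem_ofPred_eq, Finset.forall_mem_insert, inner_neg_left, neg_le_neg_iff]
  constructor
  · rintro ⟨h1, h2⟩
    exact ⟨h2.le, h2.ge, h1⟩
  · rintro ⟨h1, h2, h3⟩
    exact ⟨h3, le_antisymm h1 h2⟩

lemma exists_lt_of_face {τ : OrientedPolyhedron N (m + 1)} {F : OrientedPolyhedron N m}
    {ν : Space N} {a : ℝ} (h1 : ∀ x ∈ τ.carrier, inner ℝ ν x ≤ a)
    (h2 : F.carrier = {x ∈ τ.carrier | inner ℝ ν x = a}) :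
    ∃ x ∈ τ.carrier, inner ℝ ν x < a := by
  by_contra! hcon
  have : F.carrier = τ.carrier := by
    rw [h2]
    ext x
    exact ⟨fun h => h.1, fun h => ⟨h, le_antisymm (h1 x h) (hcon x h)⟩⟩
  have k1 := F.finrank_vectorSpan
  rw [this, τ.finrank_vectorSpan] at k1
  omega

/-- A face of a polyhedron is determined by its carrier. -/
lemma OrientedPolyhedron.IsFace.eq_of_carrier_eq {τ : OrientedPolyhedron N (m + 1)} {F F' : OrientedPolyhedron N m}
    (h : IsFace τ F) (h' : IsFace τ F') (hc : F.carrier = F'.carrier) : F = F' := by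
  obtain ⟨ν, a, h1, h2, h3, h4, h5⟩ := h
  obtain ⟨ν', a', h1', h2', h3', h4', h5'⟩ := h'
  have hsub : F.carrier ⊆ τ.carrier := by rw [h4]; exact fun x hx => hx.1
  have hν : ν' = ν := by
    refine (normal_unique (vectorSpan_mono ℝ hsub)
      (by rw [τ.finrank_vectorSpan, F.finrank_vectorSpan]) h1 h1' h2 h2'
      (fun w hw => inner_eq_zero_of_mem_vectorSpan (c := a) (fun x hx => by
        rw [h4] at hx; exact hx.2) hw)
      (fun w hw => inner_eq_zero_of_mem_vectorSpan (c := a') (fun x hx => by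
        rw [hc, h4'] at hx; exact hx.2) hw)).resolve_right fun hneg => ?_
    obtain ⟨p, hp⟩ := F.nonempty
    obtain ⟨x, hx, hxa⟩ := exists_lt_of_face h3 h4
    have e1 : inner ℝ ν p = a := by rw [h4] at hp; exact hp.2
    have e2 : inner ℝ ν' p = a' := by rw [hc, h4'] at hp; exact hp.2
    have e3 := h3' x hx
    rw [hneg, inner_neg_left] at e2 e3
    linarith
  apply OrientedPolyhedron.ext hc
  rcases η_eq_or_eq_neg (σ := F) (τ := F') (by rw [hc]) with h | h
  · exact h.symm
  · exfalso
    have e : (τ.η : ExteriorAlgebra ℝ (Space N)) = -(τ.η : ExteriorAlgebra ℝ (Space N)) := by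
      conv_lhs => rw [h5', h, hν]
      rw [h5, ← neg_mul]
      rfl
    have e0 : (τ.η : ExteriorAlgebra ℝ (Space N)) = 0 := by
      have e2 : (2 : ℝ) • (τ.η : ExteriorAlgebra ℝ (Space N)) = 0 := by
        rw [two_smul]
        nth_rewrite 1 [e]
        exact neg_add_cancel _
      exact (smul_eq_zero.1 e2).resolve_left two_ne_zero
    have e1 : τ.η = 0 := Subtype.ext e0
    have := τ.norm_η
    rw [e1, norm_zero] at this
    exact zero_ne_one this

lemma OrientedPolyhedron.IsFace.exists_constraint {τ : OrientedPolyhedron N (m + 1)} {F : OrientedPolyhedron N m}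
    (h : IsFace τ F) {H : Finset (Space N × ℝ)}
    (hH : τ.carrier = {x | ∀ h ∈ H, inner ℝ h.1 x ≤ h.2}) :
    ∃ h ∈ H, F.carrier = {x ∈ τ.carrier | inner ℝ h.1 x = h.2} := by
  classical
  obtain ⟨ν, a, h1, h2, h3, h4, -⟩ := h
  have hFτ : F.carrier ⊆ τ.carrier := by rw [h4]; exact fun x hx => hx.1
  have key : ∃ h ∈ H, (∀ x ∈ F.carrier, inner ℝ h.1 x = h.2) ∧
      ∃ x ∈ τ.carrier, inner ℝ h.1 x ≠ h.2 := by
    by_contra! hcon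
    have hx : ∀ T : Finset (Space N × ℝ), T ⊆ H → ∃ x ∈ F.carrier,
        ∀ h ∈ T, (∀ y ∈ τ.carrier, inner ℝ h.1 y = h.2) ∨ inner ℝ h.1 x < h.2 := by
      intro T
      induction T using Finset.induction_on with
      | empty =>
        obtain ⟨x, hx⟩ := F.nonempty
        exact fun _ => ⟨x, hx, by simp⟩
      | insert b T hb ih =>
        intro hT
        obtain ⟨x, hx, hxT⟩ := ih ((Finset.subset_insert _ _).trans hT)
        have hbH : b ∈ H := hT (Finset.mem_insert_self b T)
        by_cases hbF : ∀ x ∈ F.carrier, inner ℝ b.1 x = b.2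
        · refine ⟨x, hx, fun h hh => ?_⟩
          rcases Finset.mem_insert.1 hh with rfl | hh
          · exact Or.inl (hcon _ hbH hbF)
          · exact hxT h hh
        · push Not at hbF
          obtain ⟨y, hy, hyb⟩ := hbF
          have hle : ∀ z ∈ F.carrier, ∀ h ∈ H, inner ℝ h.1 z ≤ h.2 := fun z hz h hh => by
            have := hFτ hz
            rw [hH] at this
            exact this h hh
          refine ⟨(1 / 2 : ℝ) • x + (1 / 2 : ℝ) • y,
            F.convex hx hy (by norm_num) (by norm_num) (by norm_num), fun h hh => ?_⟩
          rw [inner_add_right, inner_smul_right, inner_smul_right]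
          rcases Finset.mem_insert.1 hh with rfl | hh
          · right
            have e1 := hle x hx _ hbH
            have e2 := lt_of_le_of_ne (hle y hy _ hbH) hyb
            linarith
          · refine (hxT h hh).imp id fun e1 => ?_
            have e2 := hle y hy h (hT (Finset.mem_insert_of_mem hh))
            linarith
    obtain ⟨x, hxF, hx⟩ := hx H subset_rfl
    obtain ⟨y, hy, hya⟩ := exists_lt_of_face h3 h4
    have hev : ∀ᶠ ε : ℝ in nhdsWithin 0 (Set.Ioi 0), ∀ h ∈ H,
        inner ℝ h.1 (x + ε • (x - y)) ≤ h.2 := by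
      rw [Filter.eventually_all_finset]
      intro h hh
      rcases hx h hh with e | e
      · refine Filter.Eventually.of_forall fun ε => ?_
        rw [inner_add_right, inner_smul_right, inner_sub_right, e x (hFτ hxF), e y hy]
        simp
      · have ht : Filter.Tendsto (fun ε : ℝ => inner ℝ h.1 (x + ε • (x - y)))
            (nhdsWithin 0 (Set.Ioi 0)) (nhds (inner ℝ h.1 (x + (0 : ℝ) • (x - y)))) := by
          apply Filter.Tendsto.mono_left _ nhdsWithin_le_nhds
          apply Continuous.tendsto (f := fun ε : ℝ => inner ℝ h.1 (x + ε • (x - y)))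
          fun_prop
        rw [zero_smul, add_zero] at ht
        exact (ht.eventually_lt_const e).mono fun ε hε => hε.le
    obtain ⟨ε, hε, hε0⟩ := (hev.and self_mem_nhdsWithin).exists
    have hmem : x + ε • (x - y) ∈ τ.carrier := by rw [hH]; exact hε
    have e1 := h3 _ hmem
    have e2 : inner ℝ ν x = a := by rw [h4] at hxF; exact hxF.2
    rw [inner_add_right, inner_smul_right, inner_sub_right, e2] at e1
    have e3 : 0 < ε * (a - inner ℝ ν y) := mul_pos hε0 (by linarith)
    linarith
  obtain ⟨h, hh, hF, x, hx, hne⟩ := key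
  refine ⟨h, hh, subset_antisymm (fun x hx => ⟨hFτ hx, hF x hx⟩) ?_⟩
  set K := {x ∈ τ.carrier | inner ℝ h.1 x = h.2} with hK
  have hFK : F.carrier ⊆ K := fun x hx => ⟨hFτ hx, hF x hx⟩
  obtain ⟨p, hp⟩ := F.nonempty
  have hKlt : vectorSpan ℝ K < vectorSpan ℝ τ.carrier := by
    refine lt_of_le_of_ne (vectorSpan_mono ℝ fun x hx => hx.1) fun he => hne ?_
    have hxp : x - p ∈ vectorSpan ℝ K := by rw [he]; exact vsub_mem_vectorSpan ℝ hx (hFτ hp)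
    have := inner_eq_zero_of_mem_vectorSpan (n := h.1) (c := h.2) (fun x hx => hx.2) hxp
    rw [inner_sub_right, hF p hp] at this
    linarith
  have hlt := Submodule.finrank_lt_finrank_of_lt hKlt
  rw [τ.finrank_vectorSpan] at hlt
  have heq : vectorSpan ℝ F.carrier = vectorSpan ℝ K :=
    Submodule.eq_of_le_of_finrank_le (vectorSpan_mono ℝ hFK)
      (by rw [F.finrank_vectorSpan]; omega)
  intro y hy
  exact mem_of_sub_mem_vectorSpan h4 hp hy.1
    (by rw [heq]; exact vsub_mem_vectorSpan ℝ hy (hFK hp))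

lemma finite_faces (τ : OrientedPolyhedron N (m + 1)) :
    {F : OrientedPolyhedron N m | IsFace τ F}.Finite := by
  obtain ⟨H, hH⟩ := τ.isPolyhedral
  refine Set.Finite.of_finite_image (f := OrientedPolyhedron.carrier) ?_
    fun F hF F' hF' h => IsFace.eq_of_carrier_eq hF hF' h
  refine ((H.finite_toSet).image fun h => {x ∈ τ.carrier | inner ℝ h.1 x = h.2}).subset ?_
  rintro _ ⟨F, hF, rfl⟩
  obtain ⟨h, hh, he⟩ := hF.exists_constraint hH
  exact ⟨h, hh, he.symm⟩

/-- The finite set of the oriented `m`-dimensional faces of `τ`. -/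
noncomputable def faces (τ : OrientedPolyhedron N (m + 1)) : Finset (OrientedPolyhedron N m) :=
  (finite_faces τ).toFinset

lemma mem_faces {τ : OrientedPolyhedron N (m + 1)} {F : OrientedPolyhedron N m} :
    F ∈ faces τ ↔ IsFace τ F := (finite_faces τ).mem_toFinset

lemma reverse_reverse (σ : OrientedPolyhedron N m) : σ.reverse.reverse = σ :=
  OrientedPolyhedron.ext rfl (neg_neg σ.η)

lemma OrientedPolyhedron.IsFace.reverse {τ : OrientedPolyhedron N (m + 1)} {F : OrientedPolyhedron N m}
    (h : IsFace τ F) : IsFace τ.reverse F.reverse := by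
  obtain ⟨ν, a, h1, h2, h3, h4, h5⟩ := h
  refine ⟨ν, a, h1, h2, h3, h4, ?_⟩
  change -(τ.η : ExteriorAlgebra ℝ (Space N)) = -(F.η : ExteriorAlgebra ℝ (Space N)) * _
  rw [h5, neg_mul]

end Faces

section Cutting

variable {σ σ₁ : OrientedPolyhedron N (m + 1)} {n : Space N} {c : ℝ}

lemma cutFace_finrank (h₁ : ∃ x ∈ σ.carrier, inner ℝ n x < c)
    (h₂ : ∃ x ∈ σ.carrier, c < inner ℝ n x) :
    ∃ p ∈ σ.carrier, inner ℝ n p = c ∧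
      m ≤ Module.finrank ℝ (vectorSpan ℝ {x ∈ σ.carrier | inner ℝ n x = c}) := by
  set C := {x ∈ σ.carrier | inner ℝ n x = c} with hC
  obtain ⟨x₀, hx₀, hx₀c⟩ := h₁
  obtain ⟨x₁, hx₁, hx₁c⟩ := h₂
  obtain ⟨s, hs0, hs1, hs⟩ := exists_crossing hx₀c.le hx₁c
  have hp := σ.convex.add_smul_sub_mem hx₀ hx₁ ⟨hs0, hs1.le⟩
  set p := x₀ + s • (x₁ - x₀) with hpdef
  have hpC : p ∈ C := ⟨hp, hs⟩
  refine ⟨p, hp, hs, ?_⟩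
  set S := vectorSpan ℝ C ⊔ Submodule.span ℝ {x₁ - p} with hS
  have hle : ∀ z ∈ C, z - p ∈ S := fun z hz =>
    (le_sup_left : vectorSpan ℝ C ≤ S) (vsub_mem_vectorSpan ℝ hz hpC)
  have hx₁S : x₁ - p ∈ S :=
    (le_sup_right : Submodule.span ℝ {x₁ - p} ≤ S) (Submodule.mem_span_singleton_self _)
  have haux : ∀ (y : Space N) (t : ℝ) (w : Space N), t < 1 → y + t • (w - y) - p ∈ S → w - p ∈ S → y - p ∈ S := by
    intro y t w ht h1 h2
    have h3 : (1 - t)⁻¹ • ((y + t • (w - y) - p) - t • (w - p)) ∈ S :=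
      S.smul_mem _ (S.sub_mem h1 (S.smul_mem _ h2))
    have h4 : (y + t • (w - y) - p) - t • (w - p) = (1 - t) • (y - p) := by module
    rwa [h4, smul_smul, inv_mul_cancel₀ (by linarith), one_smul] at h3
  have hlow : ∀ y ∈ σ.carrier, inner ℝ n y ≤ c → y - p ∈ S := by
    intro y hy hyc
    obtain ⟨t, ht0, ht1, ht⟩ := exists_crossing hyc hx₁c
    exact haux y t x₁ ht1 (hle _ ⟨σ.convex.add_smul_sub_mem hy hx₁ ⟨ht0, ht1.le⟩, ht⟩) hx₁S
  have hall : ∀ y ∈ σ.carrier, y - p ∈ S := by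
    intro y hy
    rcases le_total (inner ℝ n y) c with hyc | hyc
    · exact hlow y hy hyc
    · obtain ⟨t, ht0, ht1, ht⟩ := exists_crossing (n := -n) (c := -c) (y := y) (x := x₀)
        (by simpa using hyc) (by simpa using hx₀c)
      exact haux y t x₀ ht1 (hle _ ⟨σ.convex.add_smul_sub_mem hy hx₀ ⟨ht0, ht1.le⟩,
        by simpa using ht⟩) (hlow x₀ hx₀ hx₀c.le)
  have hVS : vectorSpan ℝ σ.carrier ≤ S := by
    rw [vectorSpan_eq_span_vsub_set_right ℝ hp, Submodule.span_le]
    rintro _ ⟨y, hy, rfl⟩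
    exact hall y hy
  have e1 := Submodule.finrank_mono hVS
  have e2 : Module.finrank ℝ S ≤ _ := Submodule.finrank_add_le_finrank_add_finrank
    (vectorSpan ℝ C) (Submodule.span ℝ {x₁ - p})
  have e3 : Module.finrank ℝ (Submodule.span ℝ {x₁ - p}) ≤ 1 := by
    simpa using finrank_span_le_card (R := ℝ) ({x₁ - p} : Set (Space N))
  rw [σ.finrank_vectorSpan] at e1
  omega

lemma ιMulti_snoc (b : Fin m → Space N) (ν : Space N) :
    ((exteriorPower.ιMulti ℝ (m + 1) (Fin.snoc b ν : Fin (m + 1) → Space N) :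
      MVector N (m + 1)) : ExteriorAlgebra ℝ (Space N)) =
      (exteriorPower.ιMulti ℝ m b : MVector N m) * ExteriorAlgebra.ι ℝ ν := by
  rw [exteriorPower.ιMulti_apply_coe, exteriorPower.ιMulti_apply_coe, ExteriorAlgebra.ιMulti_apply,
    ExteriorAlgebra.ιMulti_apply, List.ofFn_succ', List.concat_eq_append, List.prod_append]
  simp

lemma orthonormal_snoc {b : Fin m → Space N} (hb : Orthonormal ℝ b) {ν : Space N} (hν : ‖ν‖ = 1)
    (h : ∀ i, inner ℝ ν (b i) = 0) :
    Orthonormal ℝ (Fin.snoc b ν : Fin (m + 1) → Space N) := by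
  rw [orthonormal_iff_ite] at hb ⊢
  intro i j
  refine Fin.lastCases ?_ (fun i => ?_) i <;> refine Fin.lastCases ?_ (fun j => ?_) j
  · simp [hν]
  · simp [h, (Fin.castSucc_lt_last j).ne']
  · rw [Fin.snoc_castSucc, Fin.snoc_last, real_inner_comm, h,
      if_neg (Fin.castSucc_lt_last i).ne]
  · simp [hb i j]

/-- The common face of the two parts of a subdivided polyhedron. -/
lemma exists_cutFace {σ₂ : OrientedPolyhedron N (m + 1)}
    (h₁ : ∃ x ∈ σ.carrier, inner ℝ n x < c) (h₂ : ∃ x ∈ σ.carrier, c < inner ℝ n x)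
    (hσ₁ : σ₁.carrier = {x ∈ σ.carrier | inner ℝ n x ≤ c})
    (hσ₂ : σ₂.carrier = {x ∈ σ.carrier | c ≤ inner ℝ n x})
    (hη₁ : σ₁.η = σ.η) (hη₂ : σ₂.η = σ.η) :
    ∃ C : OrientedPolyhedron N m, C.carrier = {x ∈ σ.carrier | inner ℝ n x = c} ∧
      IsFace σ₁ C ∧ IsFace σ₂ C.reverse := by
  obtain ⟨p, hp, hpc, hm⟩ := cutFace_finrank h₁ h₂
  obtain ⟨x₀, hx₀, hx₀c⟩ := id h₁
  set C := {x ∈ σ.carrier | inner ℝ n x = c} with hC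
  set V := vectorSpan ℝ σ.carrier with hV
  set w : Space N := V.starProjection n with hw
  have hwV : w ∈ V := Submodule.starProjection_apply_mem V n
  have hwn : ∀ v ∈ V, inner ℝ w v = inner ℝ n v := by
    intro v hv
    have := Submodule.starProjection_inner_eq_zero (K := V) n v hv
    rw [inner_sub_left] at this
    linarith
  have hw0 : w ≠ 0 := by
    intro h0
    have h := hwn (x₀ - p) (vsub_mem_vectorSpan ℝ hx₀ hp)
    rw [h0, inner_zero_left, inner_sub_right, hpc] at h
    linarith
  have hwpos : 0 < ‖w‖ := norm_pos_iff.2 hw0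
  set ν : Space N := ‖w‖⁻¹ • w with hνdef
  have hν1 : ‖ν‖ = 1 := by
    rw [hνdef, norm_smul, norm_inv, norm_norm, inv_mul_cancel₀ hwpos.ne']
  have hνV : ν ∈ V := V.smul_mem _ hwV
  have hνx : ∀ x ∈ σ.carrier, inner ℝ ν x = inner ℝ ν p + ‖w‖⁻¹ * (inner ℝ n x - c) := by
    intro x hx
    have h := hwn (x - p) (vsub_mem_vectorSpan ℝ hx hp)
    rw [inner_sub_right n, hpc] at h
    have h' : inner ℝ ν (x - p) = ‖w‖⁻¹ * (inner ℝ n x - c) := by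
      rw [hνdef, real_inner_smul_left, h]
    rw [inner_sub_right] at h'
    linarith
  have hinv : 0 < ‖w‖⁻¹ := inv_pos.2 hwpos
  have hνC : ∀ v ∈ vectorSpan ℝ C, inner ℝ ν v = 0 := fun v hv =>
    inner_eq_zero_of_mem_vectorSpan (c := inner ℝ ν p)
      (fun x hx => by rw [hνx x hx.1, hx.2]; simp) hv
  have hCV : vectorSpan ℝ C ≤ V := vectorSpan_mono ℝ fun x hx => hx.1
  have hlt : vectorSpan ℝ C < V := by
    refine lt_of_le_of_ne hCV fun he => ?_
    have := hνC ν (by rw [he]; exact hνV)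
    rw [real_inner_self_eq_norm_sq, hν1] at this
    norm_num at this
  have hVf : Module.finrank ℝ V = m + 1 := σ.finrank_vectorSpan
  have hfr : Module.finrank ℝ (vectorSpan ℝ C) = m := by
    have := Submodule.finrank_lt_finrank_of_lt hlt
    omega
  set B := (stdOrthonormalBasis ℝ (vectorSpan ℝ C)).reindex (finCongr hfr) with hB
  set b : Fin m → Space N := fun i => (B i : Space N) with hb
  have hbo : Orthonormal ℝ b := B.orthonormal.comp_linearIsometry (vectorSpan ℝ C).subtypeₗᵢ
  have hbmem : ∀ i, b i ∈ vectorSpan ℝ C := fun i => (B i).2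
  have hbspan : Submodule.span ℝ (Set.range b) = vectorSpan ℝ C := by
    apply Submodule.eq_of_le_of_finrank_eq
    · rw [Submodule.span_le]
      rintro _ ⟨i, rfl⟩
      exact hbmem i
    · rw [finrank_span_eq_card hbo.linearIndependent, Fintype.card_fin, hfr]
  have hso : Orthonormal ℝ (Fin.snoc b ν : Fin (m + 1) → Space N) :=
    orthonormal_snoc hbo hν1 fun i => hνC _ (hbmem i)
  have hsspan : Submodule.span ℝ (Set.range (Fin.snoc b ν : Fin (m + 1) → Space N)) = V := by
    apply Submodule.eq_of_le_of_finrank_eq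
    · rw [Submodule.span_le]
      rintro _ ⟨i, rfl⟩
      refine Fin.lastCases ?_ (fun i => ?_) i
      · simpa using hνV
      · simpa using hCV (hbmem i)
    · rw [finrank_span_eq_card hso.linearIndependent, Fintype.card_fin, hVf]
  obtain ⟨η, hη, hση⟩ : ∃ η : MVector N m,
      (η = exteriorPower.ιMulti ℝ m b ∨ η = -exteriorPower.ιMulti ℝ m b) ∧
      (σ.η : ExteriorAlgebra ℝ (Space N)) = η * ExteriorAlgebra.ι ℝ ν := by
    have hcase : σ.η = exteriorPower.ιMulti ℝ (m + 1) (Fin.snoc b ν : Fin (m + 1) → Space N) ∨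
        σ.η = -exteriorPower.ιMulti ℝ (m + 1) (Fin.snoc b ν : Fin (m + 1) → Space N) := by
      obtain ⟨b', k1, k2, k3⟩ := σ.isOrientation
      have := eq_or_eq_neg k1 hso k2 hsspan
      rcases k3 with k3 | k3 <;> rcases this with h | h <;> simp [k3, h]
    rcases hcase with h | h
    · exact ⟨_, Or.inl rfl, by rw [h, ιMulti_snoc]⟩
    · refine ⟨_, Or.inr rfl, ?_⟩
      rw [h]
      change -((exteriorPower.ιMulti ℝ (m + 1) (Fin.snoc b ν : Fin (m + 1) → Space N) :
        MVector N (m + 1)) : ExteriorAlgebra ℝ (Space N)) =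
        -((exteriorPower.ιMulti ℝ m b : MVector N m) : ExteriorAlgebra ℝ (Space N)) * _
      rw [ιMulti_snoc, neg_mul]
  refine ⟨⟨C, ⟨p, hp, hpc⟩, σ.isBounded.subset fun x hx => hx.1,
    isPolyhedral_inter_hyperplane σ n c, η, b, hbo, hbspan, hη⟩, rfl, ?_, ?_⟩
  · refine ⟨ν, inner ℝ ν p, hν1, ?_, ?_, ?_, ?_⟩
    · rw [hσ₁, vectorSpan_cut σ.convex h₁]
      exact hνV
    · intro x hx
      rw [hσ₁] at hx
      rw [hνx x hx.1]
      nlinarith [hx.2]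
    · ext x
      rw [hσ₁]
      constructor
      · intro hx
        exact ⟨⟨hx.1, hx.2.le⟩, by rw [hνx x hx.1, hx.2]; simp⟩
      · rintro ⟨⟨hx, hxc⟩, he⟩
        rw [hνx x hx] at he
        have : ‖w‖⁻¹ * (inner ℝ n x - c) = 0 := by linarith
        rcases mul_eq_zero.1 this with h | h
        · exact absurd h hinv.ne'
        · exact ⟨hx, by linarith⟩
    · rw [hη₁]; exact hση
  · have h₂' : ∃ x ∈ σ.carrier, inner ℝ (-n) x < -c := by simpa using h₂
    have hσ₂' : σ₂.carrier = {x ∈ σ.carrier | inner ℝ (-n) x ≤ -c} := by simpa using hσ₂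
    refine ⟨-ν, inner ℝ (-ν) p, by rw [norm_neg, hν1], ?_, ?_, ?_, ?_⟩
    · rw [hσ₂', vectorSpan_cut σ.convex h₂']
      exact V.neg_mem hνV
    · intro x hx
      rw [hσ₂] at hx
      rw [inner_neg_left, inner_neg_left, hνx x hx.1]
      nlinarith [hx.2]
    · ext x
      rw [hσ₂]
      constructor
      · intro hx
        exact ⟨⟨hx.1, hx.2.ge⟩, by rw [inner_neg_left, inner_neg_left, hνx x hx.1, hx.2]; simp⟩
      · rintro ⟨⟨hx, hxc⟩, he⟩
        rw [inner_neg_left, inner_neg_left, hνx x hx] at he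
        have : ‖w‖⁻¹ * (inner ℝ n x - c) = 0 := by linarith
        rcases mul_eq_zero.1 this with h | h
        · exact absurd h hinv.ne'
        · exact ⟨hx, by linarith⟩
    · rw [hη₂]
      change _ = -(η : ExteriorAlgebra ℝ (Space N)) * _
      rw [map_neg, neg_mul_neg]
      exact hση

open Classical in
/-- The part of `F` in the half-space `{⟪n, x⟫ ≤ c}` if `F` meets the open half-space
`{⟪n, x⟫ < c}`, and `F` otherwise. -/
noncomputable def cutOrSelf (n : Space N) (c : ℝ) (F : OrientedPolyhedron N m) :
    OrientedPolyhedron N m :=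
  if h : ∃ x ∈ F.carrier, inner ℝ n x < c then F.cut n c h else F

open Classical in
lemma sum_faces_cut {K : Type*} [AddCommGroup K] (f : OrientedPolyhedron N m → K)
    (h₁ : ∃ x ∈ σ.carrier, inner ℝ n x < c)
    (hσ₁ : σ₁.carrier = {x ∈ σ.carrier | inner ℝ n x ≤ c}) (hη₁ : σ₁.η = σ.η)
    {C : OrientedPolyhedron N m} (hC : C.carrier = {x ∈ σ.carrier | inner ℝ n x = c})
    (hCσ : IsFace σ₁ C) :
    ∑ F ∈ faces σ₁, f F = f C +
      ∑ F ∈ faces σ, if ∃ x ∈ F.carrier, inner ℝ n x < c then f (cutOrSelf n c F) else 0 := by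
  have hspan : vectorSpan ℝ σ₁.carrier = vectorSpan ℝ σ.carrier := by
    rw [hσ₁, vectorSpan_cut σ.convex h₁]
  have hcut : ∀ F : OrientedPolyhedron N m, (h : ∃ x ∈ F.carrier, inner ℝ n x < c) →
      cutOrSelf n c F = F.cut n c h := fun F h => by rw [cutOrSelf, dif_pos h]
  rw [← Finset.add_sum_erase (faces σ₁) f (mem_faces.2 hCσ), ← Finset.sum_filter]
  congr 1
  symm
  refine Finset.sum_bij (fun F _ => cutOrSelf n c F) ?_ ?_ ?_ (fun _ _ => rfl)
  · intro F hF
    rw [Finset.mem_filter, mem_faces] at hF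
    obtain ⟨⟨ν, a, k1, k2, k3, k4, k5⟩, h⟩ := hF
    rw [hcut F h, Finset.mem_erase, mem_faces]
    refine ⟨fun he => ?_, ν, a, k1, by rwa [hspan], ?_, ?_, by rw [hη₁]; exact k5⟩
    · obtain ⟨x, hx, hxc⟩ := h
      have hx' : x ∈ (F.cut n c ⟨x, hx, hxc⟩).carrier := ⟨hx, hxc.le⟩
      rw [he, hC] at hx'
      exact hxc.ne hx'.2
    · intro x hx
      rw [hσ₁] at hx
      exact k3 x hx.1
    · ext x
      simp only [cut, k4, hσ₁, Set.mem_ofPred_eq]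
      tauto
  · have aux : ∀ F F' : OrientedPolyhedron N m, IsFace σ F → IsFace σ F' →
        (h : ∃ x ∈ F.carrier, inner ℝ n x < c) → (h' : ∃ x ∈ F'.carrier, inner ℝ n x < c) →
        F.cut n c h = F'.cut n c h' → F'.carrier ⊆ F.carrier := by
      rintro F F' ⟨ν, a, -, -, -, k4, -⟩ ⟨ν', a', -, -, -, k4', -⟩ h h' he x hx
      have hce : {x ∈ F.carrier | inner ℝ n x ≤ c} = {x ∈ F'.carrier | inner ℝ n x ≤ c} :=
        congrArg OrientedPolyhedron.carrier he
      have hs : vectorSpan ℝ F.carrier = vectorSpan ℝ F'.carrier := by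
        rw [← vectorSpan_cut F.convex h, ← vectorSpan_cut F'.convex h', hce]
      obtain ⟨p, hp, hpc⟩ := h
      have hp' : p ∈ {x ∈ F'.carrier | inner ℝ n x ≤ c} := hce ▸ ⟨hp, hpc.le⟩
      have hxσ : x ∈ σ.carrier := by rw [k4'] at hx; exact hx.1
      exact mem_of_sub_mem_vectorSpan k4 hp hxσ
        (by rw [hs]; exact vsub_mem_vectorSpan ℝ hx hp'.1)
    intro F hF F' hF' he
    rw [Finset.mem_filter, mem_faces] at hF hF'
    simp only [hcut F hF.2, hcut F' hF'.2] at he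
    exact hF.1.eq_of_carrier_eq hF'.1 (subset_antisymm
      (aux F' F hF'.1 hF.1 hF'.2 hF.2 he.symm) (aux F F' hF.1 hF'.1 hF.2 hF'.2 he))
  · intro F' hF'
    rw [Finset.mem_erase, mem_faces] at hF'
    obtain ⟨hne, hface⟩ := hF'
    obtain ⟨ν, a, k1, k2, k3, k4, k5⟩ := id hface
    have hsub : F'.carrier ⊆ σ₁.carrier := by rw [k4]; exact fun x hx => hx.1
    have hx₀ : ∃ x ∈ F'.carrier, inner ℝ n x < c := by
      by_contra! hcon
      apply hne
      have hFC : F'.carrier ⊆ C.carrier := fun x hx => by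
        have h := hsub hx
        rw [hσ₁] at h
        rw [hC]
        exact ⟨h.1, le_antisymm h.2 (hcon x hx)⟩
      refine hface.eq_of_carrier_eq hCσ (subset_antisymm hFC fun x hx => ?_)
      have hs : vectorSpan ℝ F'.carrier = vectorSpan ℝ C.carrier :=
        Submodule.eq_of_le_of_finrank_eq (vectorSpan_mono ℝ hFC)
          (by rw [F'.finrank_vectorSpan, C.finrank_vectorSpan])
      obtain ⟨p, hp⟩ := F'.nonempty
      refine mem_of_sub_mem_vectorSpan k4 hp ?_
        (by rw [hs]; exact vsub_mem_vectorSpan ℝ hx (hFC hp))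
      rw [hC] at hx
      rw [hσ₁]
      exact ⟨hx.1, hx.2.le⟩
    have hF'cut : {x ∈ {x ∈ σ.carrier | inner ℝ ν x = a} | inner ℝ n x ≤ c} = F'.carrier := by
      ext x
      simp only [k4, hσ₁, Set.mem_ofPred_eq]
      tauto
    have hconv : Convex ℝ {x ∈ σ.carrier | inner ℝ ν x = a} :=
      σ.convex.inter (convex_hyperplane (f := fun x => inner ℝ ν x)
        ⟨fun x y => inner_add_right _ _ _, fun a x => by simp [inner_smul_right]⟩ a)
    obtain ⟨x₀, hx₀F, hx₀c⟩ := hx₀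
    have hx₀F' := hx₀F
    rw [k4, hσ₁] at hx₀F'
    have hx₀' : ∃ x ∈ {x ∈ σ.carrier | inner ℝ ν x = a}, inner ℝ n x < c :=
      ⟨x₀, ⟨hx₀F'.1.1, hx₀F'.2⟩, hx₀c⟩
    have hs := vectorSpan_cut hconv hx₀'
    rw [hF'cut] at hs
    let F : OrientedPolyhedron N m :=
      ⟨{x ∈ σ.carrier | inner ℝ ν x = a}, ⟨x₀, hx₀F'.1.1, hx₀F'.2⟩,
        σ.isBounded.subset fun x hx => hx.1, isPolyhedral_inter_hyperplane σ ν a, F'.η,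
        by rw [← hs]; exact F'.isOrientation⟩
    refine ⟨F, ?_, ?_⟩
    · rw [Finset.mem_filter, mem_faces]
      refine ⟨⟨ν, a, k1, by rwa [← hspan], fun y hy => ?_, rfl, by rw [← hη₁]; exact k5⟩, hx₀'⟩
      obtain ⟨t, ht, ht1, htc⟩ := exists_segment_le (y := y) hx₀c
      have hz := k3 (x₀ + t • (y - x₀))
        (by rw [hσ₁]; exact ⟨σ.convex.add_smul_sub_mem hx₀F'.1.1 hy ⟨ht.le, ht1⟩, htc⟩)
      rw [inner_add_right, inner_smul_right, inner_sub_right, hx₀F'.2] at hz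
      by_contra! hlt
      have := mul_pos ht (sub_pos.2 hlt)
      linarith
    · rw [hcut F hx₀']
      exact OrientedPolyhedron.ext hF'cut rfl

lemma cut_eq_self {F : OrientedPolyhedron N m} (h : ∃ x ∈ F.carrier, inner ℝ n x < c)
    (h' : ∀ x ∈ F.carrier, inner ℝ n x ≤ c) : F.cut n c h = F :=
  OrientedPolyhedron.ext (by ext x; exact ⟨fun hx => hx.1, fun hx => ⟨hx, h' x hx⟩⟩) rfl

end Cutting

section Boundary

variable {G : Type*} [AddCommGroup G]

/-- The boundary of a formal chain: `∂(g τ) = ∑ g σ_i`, where the `σ_i` are the `m`-dimensional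
faces of `τ` with the induced orientations. -/
noncomputable def formalBoundary : FormalChain N (m + 1) G →+ FormalChain N m G :=
  Finsupp.liftAddHom fun τ => ∑ F ∈ faces τ, Finsupp.singleAddHom F

lemma formalBoundary_single (τ : OrientedPolyhedron N (m + 1)) (g : G) :
    formalBoundary (Finsupp.single τ g) = ∑ F ∈ faces τ, Finsupp.single F g := by
  simp [formalBoundary, AddMonoidHom.finsetSum_apply]

lemma toChain_formalBoundary_subdivision (g : G) (σ σ₁ σ₂ : OrientedPolyhedron N (m + 1))
    (h : IsSubdivision σ σ₁ σ₂) :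
    toChain (formalBoundary (Finsupp.single σ g)) =
      toChain (formalBoundary (Finsupp.single σ₁ g)) +
        toChain (formalBoundary (Finsupp.single σ₂ g)) := by
  classical
  obtain ⟨n, c, h₁, h₂, hσ₁, hσ₂, hη₁, hη₂⟩ := h
  obtain ⟨C, hC, hC₁, hC₂⟩ := exists_cutFace h₁ h₂ hσ₁ hσ₂ hη₁ hη₂
  have h₂' : ∃ x ∈ σ.carrier, inner ℝ (-n) x < -c := by simpa using h₂
  have hσ₂' : σ₂.carrier = {x ∈ σ.carrier | inner ℝ (-n) x ≤ -c} := by simpa using hσ₂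
  have hC' : C.reverse.carrier = {x ∈ σ.carrier | inner ℝ (-n) x = -c} := by
    change C.carrier = _
    simpa using hC
  simp only [formalBoundary_single, map_sum]
  rw [sum_faces_cut (fun F => toChain (Finsupp.single F g)) h₁ hσ₁ hη₁ hC hC₁,
    sum_faces_cut (fun F => toChain (Finsupp.single F g)) h₂' hσ₂' hη₂ hC' hC₂,
    toChain_reverse, add_add_add_comm, add_neg_cancel, zero_add, ← Finset.sum_add_distrib]
  refine Finset.sum_congr rfl fun F hF => ?_
  by_cases hl : ∃ x ∈ F.carrier, inner ℝ n x < c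
  · by_cases hr : ∃ x ∈ F.carrier, inner ℝ (-n) x < -c
    · rw [if_pos hl, if_pos hr, cutOrSelf, cutOrSelf, dif_pos hl, dif_pos hr]
      exact toChain_subdivision (F.isSubdivision_cut hl hr) g
    · rw [if_pos hl, if_neg hr, cutOrSelf, dif_pos hl, add_zero, cut_eq_self hl]
      intro x hx
      by_contra! hlt
      exact hr ⟨x, hx, by simpa using hlt⟩
  · by_cases hr : ∃ x ∈ F.carrier, inner ℝ (-n) x < -c
    · rw [if_neg hl, if_pos hr, cutOrSelf, dif_pos hr, zero_add, cut_eq_self hr]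
      intro x hx
      by_contra! hlt
      exact hl ⟨x, hx, by simpa using hlt⟩
    · exfalso
      obtain ⟨ν, a, -, -, k3, k4, -⟩ := mem_faces.1 hF
      push Not at hl hr
      have hFC : F.carrier ⊆ C.carrier := fun x hx => by
        rw [hC]
        refine ⟨by rw [k4] at hx; exact hx.1, le_antisymm ?_ (hl x hx)⟩
        simpa using hr x hx
      have hs : vectorSpan ℝ F.carrier = vectorSpan ℝ C.carrier :=
        Submodule.eq_of_le_of_finrank_eq (vectorSpan_mono ℝ hFC)
          (by rw [F.finrank_vectorSpan, C.finrank_vectorSpan])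
      obtain ⟨p, hp⟩ := F.nonempty
      obtain ⟨x₀, hx₀, hx₀c⟩ := h₁
      obtain ⟨x₁, hx₁, hx₁c⟩ := h₂
      obtain ⟨t, ht0, ht1, ht⟩ := exists_crossing hx₀c.le hx₁c
      have hz := σ.convex.add_smul_sub_mem hx₀ hx₁ ⟨ht0, ht1.le⟩
      have hzC : x₀ + t • (x₁ - x₀) ∈ C.carrier := by rw [hC]; exact ⟨hz, ht⟩
      have hzF := mem_of_sub_mem_vectorSpan k4 hp hz
        (by rw [hs]; exact vsub_mem_vectorSpan ℝ hzC (hFC hp))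
      rw [k4] at hzF
      have e0 := hzF.2
      rw [inner_add_right, inner_smul_right, inner_sub_right] at e0
      have e1 := k3 x₀ hx₀
      have e2 := k3 x₁ hx₁
      have e3 : inner ℝ ν x₀ = a := by nlinarith
      have hx₀F : x₀ ∈ F.carrier := by rw [k4]; exact ⟨hx₀, e3⟩
      exact absurd hx₀c (not_lt.2 (hl x₀ hx₀F))

/-- The boundary operator `∂ : 𝒫_{m+1}(G) → 𝒫_m(G)`. -/
noncomputable def boundary : PolyhedralChain N (m + 1) G →+ PolyhedralChain N m G :=
  chainLift (toChain.comp formalBoundary) toChain_formalBoundary_subdivision <| by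
    intro g σ
    simp only [AddMonoidHom.comp_apply, formalBoundary_single, map_sum]
    rw [← Finset.sum_neg_distrib]
    refine Finset.sum_nbij' OrientedPolyhedron.reverse OrientedPolyhedron.reverse ?_ ?_ ?_ ?_ ?_
    · intro F hF
      have := (mem_faces.1 hF).reverse
      rw [reverse_reverse] at this
      exact mem_faces.2 this
    · exact fun F hF => mem_faces.2 (mem_faces.1 hF).reverse
    · exact fun F _ => reverse_reverse F
    · exact fun F _ => reverse_reverse F
    · intro F _
      rw [toChain_reverse, neg_neg]

end Boundary

section FlatNorm

variable {G : Type*} [NormedAddCommGroup G]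

/-- The flat norm `ℱ(A) = inf_Q (M(A + ∂Q) + M(Q))`. -/
noncomputable def flatNorm (A : PolyhedralChain N m G) : ℝ :=
  ⨅ Q : PolyhedralChain N (m + 1) G, (mass (A + boundary Q) + mass Q)

lemma flatNorm_le (A : PolyhedralChain N m G) (Q : PolyhedralChain N (m + 1) G) :
    flatNorm A ≤ mass (A + boundary Q) + mass Q :=
  ciInf_le ⟨0, by rintro _ ⟨Q, rfl⟩; exact add_nonneg (mass_nonneg _) (mass_nonneg _)⟩ Q

lemma exists_lt_flatNorm (A : PolyhedralChain N m G) {ε : ℝ} (hε : 0 < ε) :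
    ∃ Q : PolyhedralChain N (m + 1) G, mass (A + boundary Q) + mass Q < flatNorm A + ε :=
  exists_lt_of_ciInf_lt (lt_add_of_pos_right _ hε)

/-- The flat norm as a seminorm on the group of polyhedral chains. -/
noncomputable def flatSeminorm (N m : ℕ) (G : Type*) [NormedAddCommGroup G] :
    AddGroupSeminorm (PolyhedralChain N m G) where
  toFun := flatNorm
  map_zero' := by
    apply le_antisymm
    · simpa [mass_zero] using flatNorm_le (0 : PolyhedralChain N m G) 0
    · exact le_ciInf fun Q => add_nonneg (mass_nonneg _) (mass_nonneg _)
  add_le' A B := by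
    apply le_of_forall_pos_le_add
    intro ε hε
    obtain ⟨P, hP⟩ := exists_lt_flatNorm A (half_pos hε)
    obtain ⟨Q, hQ⟩ := exists_lt_flatNorm B (half_pos hε)
    have h1 := flatNorm_le (A + B) (P + Q)
    rw [map_add, add_add_add_comm] at h1
    linarith [mass_add_le (A + boundary P) (B + boundary Q), mass_add_le P Q]
  neg' A := by
    have key : ∀ A : PolyhedralChain N m G, flatNorm (-A) ≤ flatNorm A := fun A => by
      refine le_ciInf fun Q => ?_
      have h1 := flatNorm_le (-A) (-Q)
      rwa [map_neg, ← neg_add, mass_neg, mass_neg] at h1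
    apply le_antisymm (key A)
    simpa using key (-A)

/-- Polyhedral chains carry the (pseudo)metric of the flat norm: `‖A‖ = flatNorm A`. -/
noncomputable instance (N m : ℕ) (G : Type*) [NormedAddCommGroup G] :
    SeminormedAddCommGroup (PolyhedralChain N m G) :=
  (flatSeminorm N m G).toSeminormedAddCommGroup

/-- The group `ℱ_m(G)` of flat `m`-chains: the completion of the group of polyhedral chains with
respect to the flat norm. Its norm is the flat norm of flat chains. -/
abbrev FlatChain (N m : ℕ) (G : Type*) [NormedAddCommGroup G] : Type _ :=
  UniformSpace.Completion (PolyhedralChain N m G)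

/-- The mass of a flat chain `A`: the infimum of `liminf M(A_i)` over all sequences of polyhedral
chains `A_i` that converge to `A` in the flat norm. -/
noncomputable def flatMass (A : FlatChain N m G) : ENNReal :=
  ⨅ (P : ℕ → PolyhedralChain N m G)
    (_ : Filter.Tendsto (fun i => (P i : FlatChain N m G)) Filter.atTop (nhds A)),
    Filter.liminf (fun i => ENNReal.ofReal (mass (P i))) Filter.atTop

end FlatNorm

/-- The homomorphism `Φ(∑ g_i [σ_i]) = ∑ (g_i · η(σ_i)) H^m(σ_i)` on polyhedral chains with
coefficients in `Λ_m ℝ^N`. -/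
noncomputable def calibration (N m : ℕ) : PolyhedralChain N m (MVector N m) →+ ℝ :=
  chainLift (Finsupp.liftAddHom fun σ : OrientedPolyhedron N m =>
      (AddMonoidHom.mulRight σ.area).comp ((innerₛₗ ℝ).flip σ.η).toAddMonoidHom)
    (by
      intro g σ σ₁ σ₂ h
      have ha := area_of_isSubdivision h
      obtain ⟨n, c, -, -, -, -, h1, h2⟩ := h
      simp [h1, h2, ha, mul_add])
    (by
      intro g σ
      have ha : σ.reverse.area = σ.area := rfl
      have hη : σ.reverse.η = -σ.η := rfl
      simp [ha, hη])

end FlatChains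

/-! The value `Φ(g[σ])` is the pairing of `g` with `ℋ^m(σ) η(σ)`, so `Φ(∂(g[τ])) = 0` for every `g`
amounts to the vector identity `∑ ℋ^m(F) η(F) = 0` over the faces `F` of an `(m+1)`-dimensional
polyhedron `τ` (`sum_area_smul_η`). This is Stokes' theorem for forms with constant coefficients. If
`ν_F` is the outer unit normal, then `η(τ) = η(F) ∧ ν_F`, so `η(F)` is the contraction of `η(τ)`
with `ν_F` (`contractRight_η`). Contraction is linear in the vector, and the identity reduces to
Minkowski's relation `∑ ℋ^m(F) ν_F = 0` (`sum_area_smul_normal`).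

Minkowski's relation comes from computing a volume in many ways. For any `p` in `τ`, the cones with
apex `p` over the faces fill `τ` without overlap, and a cone of height `h` over `F` has volume `h
ℋ^m(F) / (m+1)`. Hence `(m+1) ℋ^{m+1}(τ) = ∑ (a_F - ν_F · p) ℋ^m(F)` (`area_eq_sum_faces`). The left
side does not depend on `p`, so the vector `w = ∑ ℋ^m(F) ν_F` is orthogonal to the direction of `τ`.
It also lies in that direction, so it vanishes.

The inequalities are then formal. Cauchy-Schwarz and `|η(σ)| = 1` give `Φ ≤ M`. Since `Φ` ignores
boundaries, `Φ(A) = Φ(A + ∂Q) ≤ M(A + ∂Q) + M(Q)`, that is, `Φ ≤ ℱ`. Applied to `±A`, this is a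
Lipschitz bound, so `Φ` extends to the completion, and the inequalities pass to limits. -/

namespace FlatChains

open MeasureTheory Module OrientedPolyhedron

/-! ### Volume of a cone in an inner product space. -/

section ConeMeasure

variable {V : Type*} [NormedAddCommGroup V] [InnerProductSpace ℝ V] [MeasurableSpace V]
  [BorelSpace V] [FiniteDimensional ℝ V]

/-- The measure of a cone with apex `0` over a base in the hyperplane `{⟪ν, x⟫ = h}`. -/
lemma measure_cone_zero {m : ℕ} (hV : finrank ℝ V = m + 1) {ν : V} (hν : ‖ν‖ = 1) {h : ℝ}
    (hh : 0 < h) {B : Set V} (hB : IsCompact B) (hBν : ∀ y ∈ B, inner ℝ ν y = h) :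
    μHE[m + 1] ((fun q : ℝ × V => q.1 • q.2) '' (Set.Icc 0 1 ×ˢ B)) =
      ENNReal.ofReal (h / (m + 1)) * μHE[m] B := by
  set K := (fun q : ℝ × V => q.1 • q.2) '' (Set.Icc 0 1 ×ˢ B) with hK
  have hKm : MeasurableSet K :=
    ((isCompact_Icc.prod hB).image (by fun_prop)).isClosed.measurableSet
  have hν0 : ν ≠ 0 := fun h0 => by simp [h0] at hν
  have hmem : ∀ (x : ℝ) (y : V),
      y ∈ AffineSubspace.mk' (x • ν +ᵥ (0 : V)) (Submodule.span ℝ {ν})ᗮ ↔ inner ℝ ν y = x := by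
    intro x y
    rw [AffineSubspace.mem_mk', Submodule.mem_orthogonal_singleton_iff_inner_right]
    simp [inner_sub_right, inner_smul_right, hν, sub_eq_zero]
  -- The slice at height `x` in `(0, h]` is the copy of `B` scaled by `x / h`. Height `0` is
  -- excluded because for `m = 0` the apex has positive measure, whereas the indicator vanishes
  -- there; a single height does not affect the integral.
  have hslice : ∀ x : ℝ, x ≠ 0 →
      μHE[m] (K ∩ AffineSubspace.mk' (x • ν +ᵥ (0 : V)) (Submodule.span ℝ {ν})ᗮ) =
        (Set.Ioc 0 h).indicator (fun x => ENNReal.ofReal ((x / h) ^ m) * μHE[m] B) x := by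
    intro x hx0
    by_cases hx : x ∈ Set.Ioc 0 h
    · rw [Set.indicator_of_mem hx]
      have hpos : 0 < x / h := div_pos hx.1 hh
      have hset : K ∩ AffineSubspace.mk' (x • ν +ᵥ (0 : V)) (Submodule.span ℝ {ν})ᗮ =
          AffineMap.homothety (0 : V) (x / h) '' B := by
        ext z
        constructor
        · rintro ⟨⟨⟨t, y⟩, ⟨-, hy⟩, rfl⟩, hz⟩
          have hz := (hmem _ _).1 hz
          simp only [inner_smul_right, hBν y hy] at hz
          exact ⟨y, hy, by simp [AffineMap.homothety_apply, ← hz, hh.ne']⟩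
        · rintro ⟨y, hy, rfl⟩
          refine ⟨⟨(x / h, y), ⟨⟨hpos.le, (div_le_one hh).2 hx.2⟩, hy⟩,
            by simp [AffineMap.homothety_apply]⟩, (hmem _ _).2 ?_⟩
          simp [AffineMap.homothety_apply, inner_smul_right, hBν y hy, hh.ne']
      rw [hset, euclideanHausdorffMeasure_homothety_image m (0 : V) hpos.ne' B,
        ENNReal.smul_def, smul_eq_mul]
      congr 1
      rw [ENNReal.ofReal, ENNReal.coe_inj]
      ext
      simp [abs_of_pos hx.1, abs_of_pos hh, Real.coe_toNNReal _ (pow_nonneg hpos.le m)]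
    · rw [Set.indicator_of_notMem hx]
      refine (congrArg μHE[m] ?_).trans measure_empty
      rw [Set.eq_empty_iff_forall_notMem]
      rintro z ⟨⟨⟨t, y⟩, ⟨ht, hy⟩, rfl⟩, hz⟩
      have hz := (hmem _ _).1 hz
      simp only [inner_smul_right, hBν y hy] at hz
      have ht0 : 0 ≤ t := ht.1
      have ht1 : t ≤ 1 := ht.2
      refine hx ⟨lt_of_le_of_ne ?_ hx0.symm, ?_⟩ <;> nlinarith
  -- Fubini: the volume is the integral of the measures of the slices orthogonal to `ν`.
  have hF := EuclideanGeometry.euclideanHausdorffMeasure_eq_lintegral (0 : V) hν0 hKm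
  rw [hV, Nat.add_sub_cancel] at hF
  rw [hF]
  have hne : ‖ν‖ₑ = 1 := by rw [← ofReal_norm, hν, ENNReal.ofReal_one]
  rw [hne, one_mul, lintegral_congr_ae (g := (Set.Ioc 0 h).indicator
    fun x => ENNReal.ofReal ((x / h) ^ m) * μHE[m] B)
    ((Measure.ae_ne volume (0 : ℝ)).mono hslice), lintegral_indicator measurableSet_Ioc,
    lintegral_mul_const _ (by fun_prop)]
  congr 1
  -- What remains is `∫₀ʰ (x / h)^m dx = h / (m + 1)`.
  rw [← ofReal_integral_eq_lintegral_ofReal]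
  · rw [← intervalIntegral.integral_of_le hh.le]
    congr 1
    simp only [div_pow, intervalIntegral.integral_div, integral_pow]
    field_simp
    simp [pow_succ]
  · exact (Continuous.integrableOn_Icc (by fun_prop)).mono_set Set.Ioc_subset_Icc_self
  · refine (ae_restrict_mem measurableSet_Ioc).mono fun x hx => ?_
    exact pow_nonneg (div_nonneg hx.1.le hh.le) m

end ConeMeasure

variable {N m : ℕ}

/-! ### Cones in Euclidean space. -/

/-- The cone with apex `p` over `S`. -/
def coneOver (p : Space N) (S : Set (Space N)) : Set (Space N) :=
  (fun q : ℝ × Space N => p + q.1 • (q.2 - p)) '' (Set.Icc 0 1 ×ˢ S)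

lemma mem_coneOver {p x : Space N} {S : Set (Space N)} :
    x ∈ coneOver p S ↔ ∃ t : ℝ, 0 ≤ t ∧ t ≤ 1 ∧ ∃ y ∈ S, x = p + t • (y - p) := by
  constructor
  · rintro ⟨⟨t, y⟩, ⟨ht, hy⟩, rfl⟩
    exact ⟨t, ht.1, ht.2, y, hy, rfl⟩
  · rintro ⟨t, h0, h1, y, hy, rfl⟩
    exact ⟨(t, y), ⟨⟨h0, h1⟩, hy⟩, rfl⟩

lemma isCompact_coneOver (p : Space N) {S : Set (Space N)} (hS : IsCompact S) :
    IsCompact (coneOver p S) :=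
  (isCompact_Icc.prod hS).image (by fun_prop)

lemma OrientedPolyhedron.isCompact (σ : OrientedPolyhedron N m) : IsCompact σ.carrier :=
  Metric.isCompact_of_isClosed_isBounded σ.isClosed σ.isBounded

/-- Slicing by hyperplanes requires an ambient space of dimension exactly `m + 1`. The isometry `v ↦
p + v` carries `V` onto the affine subspace containing the cone and preserves Hausdorff measures, so
`measure_cone_zero` applies inside `V`. -/
lemma measure_coneOver {V : Submodule ℝ (Space N)} (hV : finrank ℝ V = m + 1) {ν : Space N}
    (hνV : ν ∈ V) (hν : ‖ν‖ = 1) {h : ℝ} (hh : 0 < h) {p : Space N} {B : Set (Space N)}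
    (hB : IsCompact B) (hBV : ∀ y ∈ B, y - p ∈ V) (hBν : ∀ y ∈ B, inner ℝ ν (y - p) = h) :
    μHE[m + 1] (coneOver p B) = ENNReal.ofReal (h / (m + 1)) * μHE[m] B := by
  have hi : Isometry fun v : V => p + (v : Space N) :=
    (isometry_add_left p).comp isometry_subtype_coe
  set B' : Set V := (fun v : V => p + (v : Space N)) ⁻¹' B with hB'
  have himg : (fun v : V => p + (v : Space N)) '' B' = B := by
    refine Set.image_preimage_eq_of_subset fun y hy => ⟨⟨y - p, hBV y hy⟩, by simp⟩
  have hB'c : IsCompact B' := by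
    apply hi.isClosedEmbedding.isCompact_preimage hB
  have hcone : coneOver p B = (fun v : V => p + (v : Space N)) ''
      ((fun q : ℝ × V => q.1 • q.2) '' (Set.Icc 0 1 ×ˢ B')) := by
    ext x
    rw [mem_coneOver]
    constructor
    · rintro ⟨t, h0, h1, y, hy, rfl⟩
      exact ⟨_, ⟨(t, ⟨y - p, hBV y hy⟩), ⟨⟨h0, h1⟩, by simpa [hB'] using hy⟩, rfl⟩, by simp⟩
    · rintro ⟨_, ⟨⟨t, v⟩, ⟨ht, hv⟩, rfl⟩, rfl⟩
      exact ⟨t, ht.1, ht.2, p + v, hv, by simp⟩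
  rw [hcone, hi.euclideanHausdorffMeasure_image,
    measure_cone_zero hV (ν := (⟨ν, hνV⟩ : V)) hν hh hB'c, ← hi.euclideanHausdorffMeasure_image,
    himg]
  intro v hv
  simpa using hBν _ hv

/-- A subset of an affine subspace of small dimension is a null set. -/
lemma measure_eq_zero_of_finrank_lt {k : ℕ} {p : Space N} {D : Submodule ℝ (Space N)}
    (hD : finrank ℝ D < k) {S : Set (Space N)} (hS : ∀ x ∈ S, x - p ∈ D) : μHE[k] S = 0 := by
  refine measure_mono_null (t := (AffineSubspace.mk' p D : Set (Space N)))
    (fun x hx => by simpa [AffineSubspace.mem_mk'] using hS x hx) ?_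
  rw [Measure.euclideanHausdorffMeasure_def, Measure.smul_apply]
  suffices Measure.hausdorffMeasure (k : ℝ) (AffineSubspace.mk' p D : Set (Space N)) = 0 by
    rw [this, smul_zero]
  have := Real.Convex.dimH_eq_finrank_vectorSpan (AffineSubspace.mk' p D).convex
    ⟨p, AffineSubspace.self_mem_mk' p D⟩
  rw [← AffineSubspace.direction_eq_vectorSpan, AffineSubspace.direction_mk'] at this
  exact hausdorffMeasure_of_dimH_lt (d := (k : NNReal)) (by rw [this]; exact_mod_cast hD)

/-- Coning raises the dimension by at most one: for any `y ∈ S`, the cone lies in the translate by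
`p` of `vectorSpan ℝ S + ℝ(y - p)`. -/
lemma measure_coneOver_eq_zero {p : Space N} {S : Set (Space N)}
    (hS : finrank ℝ (vectorSpan ℝ S) < m) : μHE[m + 1] (coneOver p S) = 0 := by
  rcases S.eq_empty_or_nonempty with rfl | ⟨y, hy⟩
  · simp [coneOver]
  set D := vectorSpan ℝ S ⊔ Submodule.span ℝ {y - p} with hD
  have e2 : finrank ℝ D ≤ _ := Submodule.finrank_add_le_finrank_add_finrank
    (vectorSpan ℝ S) (Submodule.span ℝ {y - p})
  have e3 : finrank ℝ (Submodule.span ℝ {y - p}) ≤ 1 := by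
    simpa using finrank_span_le_card (R := ℝ) ({y - p} : Set (Space N))
  refine measure_eq_zero_of_finrank_lt (p := p) (D := D) (by omega) fun x hx => ?_
  obtain ⟨t, -, -, z, hz, rfl⟩ := mem_coneOver.1 hx
  have h1 : z - y ∈ D := (le_sup_left : _ ≤ D) (vsub_mem_vectorSpan ℝ hz hy)
  have h2 : y - p ∈ D := (le_sup_right : _ ≤ D) (Submodule.mem_span_singleton_self _)
  have h3 := D.smul_mem t (D.add_mem h1 h2)
  rwa [sub_add_sub_cancel, ← add_sub_cancel_left p (t • (z - p))] at h3

/-! ### Facets, and how rays and cones meet them. -/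

/-- A facet cut out by a supporting hyperplane underlies an oriented face. -/
lemma exists_isFace {σ : OrientedPolyhedron N (m + 1)} {n : Space N} {c : ℝ}
    (hle : ∀ x ∈ σ.carrier, inner ℝ n x ≤ c) (hlt : ∃ x ∈ σ.carrier, inner ℝ n x < c)
    (hfr : finrank ℝ (vectorSpan ℝ {x ∈ σ.carrier | inner ℝ n x = c}) = m)
    (hne : {x ∈ σ.carrier | inner ℝ n x = c}.Nonempty) :
    ∃ F : OrientedPolyhedron N m, IsFace σ F ∧ F.carrier = {x ∈ σ.carrier | inner ℝ n x = c} := by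
  obtain ⟨p, hp, hpc⟩ := id hne
  obtain ⟨x₀, hx₀, hx₀c⟩ := hlt
  set C := {x ∈ σ.carrier | inner ℝ n x = c} with hC
  set V := vectorSpan ℝ σ.carrier with hV
  -- `n` need not be tangent to `σ`, as `IsFace` demands of a normal. On `σ` only its projection to
  -- `V` matters, up to an additive constant.
  set w : Space N := V.starProjection n with hw
  have hwV : w ∈ V := Submodule.starProjection_apply_mem V n
  have hwn : ∀ v ∈ V, inner ℝ w v = inner ℝ n v := by
    intro v hv
    have := Submodule.starProjection_inner_eq_zero (K := V) n v hv
    rw [inner_sub_left] at this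
    linarith
  have hw0 : w ≠ 0 := by
    intro h0
    have h := hwn (x₀ - p) (vsub_mem_vectorSpan ℝ hx₀ hp)
    rw [h0, inner_zero_left, inner_sub_right, hpc] at h
    linarith
  have hwpos : 0 < ‖w‖ := norm_pos_iff.2 hw0
  have hinv : 0 < ‖w‖⁻¹ := inv_pos.2 hwpos
  set ν : Space N := ‖w‖⁻¹ • w with hνdef
  have hν1 : ‖ν‖ = 1 := by
    rw [hνdef, norm_smul, norm_inv, norm_norm, inv_mul_cancel₀ hwpos.ne']
  have hνV : ν ∈ V := V.smul_mem _ hwV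
  -- On `σ`, the functional of `ν` is an increasing affine function of that of `n`, so both attain
  -- their maximum on the same set `C`.
  have hνx : ∀ x ∈ σ.carrier, inner ℝ ν x = inner ℝ ν p + ‖w‖⁻¹ * (inner ℝ n x - c) := by
    intro x hx
    have h := hwn (x - p) (vsub_mem_vectorSpan ℝ hx hp)
    rw [inner_sub_right n, hpc] at h
    have h' : inner ℝ ν (x - p) = ‖w‖⁻¹ * (inner ℝ n x - c) := by
      rw [hνdef, real_inner_smul_left, h]
    rw [inner_sub_right] at h'
    linarith
  have hνC : ∀ v ∈ vectorSpan ℝ C, inner ℝ ν v = 0 := fun v hv =>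
    inner_eq_zero_of_mem_vectorSpan (c := inner ℝ ν p)
      (fun x hx => by rw [hνx x hx.1, hx.2]; simp) hv
  have hCV : vectorSpan ℝ C ≤ V := vectorSpan_mono ℝ fun x hx => hx.1
  have hVf : finrank ℝ V = m + 1 := σ.finrank_vectorSpan
  set B := (stdOrthonormalBasis ℝ (vectorSpan ℝ C)).reindex (finCongr hfr) with hB
  set b : Fin m → Space N := fun i => (B i : Space N) with hb
  have hbo : Orthonormal ℝ b := B.orthonormal.comp_linearIsometry (vectorSpan ℝ C).subtypeₗᵢ
  have hbmem : ∀ i, b i ∈ vectorSpan ℝ C := fun i => (B i).2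
  have hbspan : Submodule.span ℝ (Set.range b) = vectorSpan ℝ C := by
    apply Submodule.eq_of_le_of_finrank_eq
    · rw [Submodule.span_le]
      rintro _ ⟨i, rfl⟩
      exact hbmem i
    · rw [finrank_span_eq_card hbo.linearIndependent, Fintype.card_fin, hfr]
  have hso : Orthonormal ℝ (Fin.snoc b ν : Fin (m + 1) → Space N) :=
    orthonormal_snoc hbo hν1 fun i => hνC _ (hbmem i)
  have hsspan : Submodule.span ℝ (Set.range (Fin.snoc b ν : Fin (m + 1) → Space N)) = V := by
    apply Submodule.eq_of_le_of_finrank_eq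
    · rw [Submodule.span_le]
      rintro _ ⟨i, rfl⟩
      refine Fin.lastCases ?_ (fun i => ?_) i
      · simpa using hνV
      · simpa using hCV (hbmem i)
    · rw [finrank_span_eq_card hso.linearIndependent, Fintype.card_fin, hVf]
  -- Appending `ν` to an orthonormal basis of the direction of `C` gives one of `V`, so `σ.η` is its
  -- wedge product up to a sign, which is absorbed into the orientation of the face.
  obtain ⟨η, hη, hση⟩ : ∃ η : MVector N m,
      (η = exteriorPower.ιMulti ℝ m b ∨ η = -exteriorPower.ιMulti ℝ m b) ∧
      (σ.η : ExteriorAlgebra ℝ (Space N)) = η * ExteriorAlgebra.ι ℝ ν := by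
    obtain ⟨b', k1, k2, k3⟩ := σ.isOrientation
    have hcase : σ.η = exteriorPower.ιMulti ℝ (m + 1) (Fin.snoc b ν : Fin (m + 1) → Space N) ∨
        σ.η = -exteriorPower.ιMulti ℝ (m + 1) (Fin.snoc b ν : Fin (m + 1) → Space N) := by
      have := eq_or_eq_neg k1 hso k2 hsspan
      rcases k3 with k3 | k3 <;> rcases this with h | h <;> simp [k3, h]
    rcases hcase with h | h
    · exact ⟨_, Or.inl rfl, by rw [h, ιMulti_snoc]⟩
    · refine ⟨_, Or.inr rfl, ?_⟩
      rw [h, NegMemClass.coe_neg, NegMemClass.coe_neg, ιMulti_snoc, neg_mul]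
  refine ⟨⟨C, hne, σ.isBounded.subset fun x hx => hx.1, isPolyhedral_inter_hyperplane σ n c, η, b,
    hbo, hbspan, hη⟩, ⟨ν, inner ℝ ν p, hν1, hνV, fun x hx => ?_, ?_, hση⟩, rfl⟩
  · rw [hνx x hx]
    nlinarith [hle x hx]
  · ext x
    constructor
    · intro hx
      exact ⟨hx.1, by rw [hνx x hx.1, hx.2]; simp⟩
    · rintro ⟨hx, he⟩
      rw [hνx x hx, add_eq_left, mul_eq_zero, sub_eq_zero] at he
      exact ⟨hx, he.resolve_left hinv.ne'⟩

/-- The ray from a point `p` of a polyhedron through another point `x` leaves the polyhedron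
through the relative boundary. -/
lemma exists_exit {P : Set (Space N)} (hP : Bornology.IsBounded P) {H : Finset (Space N × ℝ)}
    (hH : P = {x | ∀ h ∈ H, inner ℝ h.1 x ≤ h.2}) {p x : Space N} (hp : p ∈ P) (hx : x ∈ P)
    (hxp : x ≠ p) :
    ∃ h ∈ H, inner ℝ h.1 p < h.2 ∧ x ∈ coneOver p {y ∈ P | inner ℝ h.1 y = h.2} := by
  classical
  have hpH : ∀ h ∈ H, inner ℝ h.1 p ≤ h.2 := by rw [hH] at hp; exact hp
  have hxH : ∀ h ∈ H, inner ℝ h.1 x ≤ h.2 := by rw [hH] at hx; exact hx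
  -- Only constraints that increase in the direction `x - p` can stop the ray. If there were none,
  -- the whole ray would stay in the bounded set `P`.
  set H' := H.filter fun h => 0 < inner ℝ h.1 (x - p) with hH'
  have hne : H'.Nonempty := by
    by_contra hemp
    rw [Finset.not_nonempty_iff_eq_empty, hH', Finset.filter_eq_empty_iff] at hemp
    obtain ⟨R, hR⟩ := hP.exists_norm_le
    have hd : 0 < ‖x - p‖ := norm_pos_iff.2 (sub_ne_zero.2 hxp)
    have hR0 : 0 ≤ R := (norm_nonneg _).trans (hR p hp)
    -- This step along the ray has length `2R + 1`, while two points of norm at most `R` are at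
    -- distance at most `2R`.
    set s := (2 * R + 1) / ‖x - p‖ with hs
    have hs0 : 0 ≤ s := by positivity
    have hmem : p + s • (x - p) ∈ P := by
      rw [hH]
      intro h hh
      rw [inner_add_right, inner_smul_right]
      nlinarith [hpH h hh, mul_nonneg hs0 (sub_nonneg.2 (not_lt.1 (hemp hh)))]
    have h1 := hR _ hmem
    have h2 : ‖s • (x - p)‖ = 2 * R + 1 := by
      rw [norm_smul, Real.norm_of_nonneg hs0, hs, div_mul_cancel₀ _ hd.ne']
    have h3 := norm_sub_le (p + s • (x - p)) p
    rw [add_sub_cancel_left, h2] at h3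
    linarith [hR p hp]
  -- `h` is a constraint that the ray `p + t(x - p)` reaches first, at `t = T`. As `x` satisfies it,
  -- `T ≥ 1`, and `x` sits at parameter `T⁻¹` on the segment from `p` to the exit point.
  obtain ⟨h, hh, hmin⟩ := H'.exists_min_image
    (fun h => (h.2 - inner ℝ h.1 p) / inner ℝ h.1 (x - p)) hne
  obtain ⟨hhH, hpos⟩ := Finset.mem_filter.1 hh
  set T := (h.2 - inner ℝ h.1 p) / inner ℝ h.1 (x - p) with hT
  have hT1 : 1 ≤ T := by
    rw [hT, le_div_iff₀ hpos, inner_sub_right]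
    linarith [hxH h hhH]
  have hTh : T * inner ℝ h.1 (x - p) = h.2 - inner ℝ h.1 p := div_mul_cancel₀ _ hpos.ne'
  have hT0 : 0 < T := by linarith
  refine ⟨h, hhH, by nlinarith, mem_coneOver.2 ⟨T⁻¹, by positivity, inv_le_one_of_one_le₀ hT1,
    p + T • (x - p), ⟨?_, ?_⟩, ?_⟩⟩
  · rw [hH]
    intro k hk
    rw [inner_add_right, inner_smul_right]
    by_cases hkp : 0 < inner ℝ k.1 (x - p)
    · have := hmin k (Finset.mem_filter.2 ⟨hk, hkp⟩)
      rw [le_div_iff₀ hkp] at this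
      linarith
    · nlinarith [hpH k hk]
  · rw [inner_add_right, inner_smul_right, hTh]
    ring
  · rw [add_sub_cancel_left, smul_smul, inv_mul_cancel₀ hT0.ne', one_smul, add_sub_cancel]

/-- Cones over two sets in different supporting hyperplanes meet in the cone over their
intersection. -/
lemma coneOver_inter_subset {P : Set (Space N)} {ν ν' p : Space N}
    {a a' : ℝ} (h : ∀ x ∈ P, inner ℝ ν x ≤ a) (h' : ∀ x ∈ P, inner ℝ ν' x ≤ a')
    (hpa : inner ℝ ν p < a) (hpa' : inner ℝ ν' p < a') :
    coneOver p {x ∈ P | inner ℝ ν x = a} ∩ coneOver p {x ∈ P | inner ℝ ν' x = a'} ⊆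
      insert p (coneOver p ({x ∈ P | inner ℝ ν x = a} ∩ {x ∈ P | inner ℝ ν' x = a'})) := by
  rintro x ⟨hx, hx'⟩
  obtain ⟨t, ht0, ht1, y, ⟨hy, hya⟩, rfl⟩ := mem_coneOver.1 hx
  obtain ⟨s, hs0, hs1, z, ⟨hz, hza⟩, he⟩ := mem_coneOver.1 hx'
  rcases ht0.eq_or_lt with rfl | ht0
  · exact Or.inl (by simp)
  right
  have he' : t • (y - p) = s • (z - p) := add_left_cancel he
  -- Pairing with `ν` gives `t ≤ s`, because `z` does not exceed the level `a` and `p` is strictly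
  -- below it. Pairing with `ν'` gives `s ≤ t`. With `t = s > 0` the two base points coincide.
  have e1 : t * (a - inner ℝ ν p) = s * (inner ℝ ν z - inner ℝ ν p) := by
    have := congrArg (fun v => inner ℝ ν v) he'
    simpa only [inner_smul_right, inner_sub_right, hya] using this
  have e2 : t * (inner ℝ ν' y - inner ℝ ν' p) = s * (a' - inner ℝ ν' p) := by
    have := congrArg (fun v => inner ℝ ν' v) he'
    simpa only [inner_smul_right, inner_sub_right, hza] using this
  have hts : t = s := by
    apply le_antisymm
    · have := mul_le_mul_of_nonneg_left (h z hz) hs0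
      by_contra! hlt
      nlinarith [mul_pos (sub_pos.2 hlt) (sub_pos.2 hpa)]
    · have := mul_le_mul_of_nonneg_left (h' y hy) ht0.le
      by_contra! hlt
      nlinarith [mul_pos (sub_pos.2 hlt) (sub_pos.2 hpa')]
  rw [← hts] at he'
  have hyz : y = z := by
    have := smul_right_injective (Space N) ht0.ne' he'
    exact sub_left_injective this
  exact mem_coneOver.2 ⟨t, ht0.le, ht1, y, ⟨⟨hy, hya⟩, hyz ▸ ⟨hz, hza⟩⟩, rfl⟩

/-- Distinct faces of a polyhedron meet in a set of smaller dimension. -/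
lemma finrank_vectorSpan_inter_lt {τ : OrientedPolyhedron N (m + 1)}
    {F F' : OrientedPolyhedron N m} (hF : IsFace τ F) (hF' : IsFace τ F') (hne : F ≠ F')
    (hi : (F.carrier ∩ F'.carrier).Nonempty) :
    finrank ℝ (vectorSpan ℝ (F.carrier ∩ F'.carrier)) < m := by
  by_contra! hcon
  obtain ⟨q, hq, hq'⟩ := hi
  -- If the intersection had full dimension `m`, both faces would have its direction. Each face
  -- contains every point of `τ` whose difference from `q` lies in its own direction, so the two
  -- would be equal.
  have aux : ∀ {E : OrientedPolyhedron N m}, F.carrier ∩ F'.carrier ⊆ E.carrier →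
      vectorSpan ℝ (F.carrier ∩ F'.carrier) = vectorSpan ℝ E.carrier := fun {E} hE =>
    Submodule.eq_of_le_of_finrank_le (vectorSpan_mono ℝ hE) (by rwa [E.finrank_vectorSpan])
  have h1 := aux (E := F) Set.inter_subset_left
  have h2 := aux (E := F') Set.inter_subset_right
  apply hne
  refine hF.eq_of_carrier_eq hF' ?_
  obtain ⟨ν, a, -, -, -, k, -⟩ := hF
  obtain ⟨ν', a', -, -, -, k', -⟩ := hF'
  apply subset_antisymm
  · intro x hx
    refine mem_of_sub_mem_vectorSpan k' hq' ?_ ?_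
    · rw [k] at hx; exact hx.1
    · rw [← h2, h1]; exact vsub_mem_vectorSpan ℝ hx hq
  · intro x hx
    refine mem_of_sub_mem_vectorSpan k hq ?_ ?_
    · rw [k'] at hx; exact hx.1
    · rw [← h1, h2]; exact vsub_mem_vectorSpan ℝ hx hq'

/-! ### Cone decomposition and Minkowski's relation. -/

/-- The volume of a polyhedron, decomposed into the cones over its faces. -/
lemma area_eq_sum_faces (τ : OrientedPolyhedron N (m + 1)) {ν : OrientedPolyhedron N m → Space N}
    {a : OrientedPolyhedron N m → ℝ}
    (hν : ∀ F ∈ faces τ, ‖ν F‖ = 1 ∧ ν F ∈ vectorSpan ℝ τ.carrier ∧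
      (∀ x ∈ τ.carrier, inner ℝ (ν F) x ≤ a F) ∧
      F.carrier = {x ∈ τ.carrier | inner ℝ (ν F) x = a F})
    {p : Space N} (hp : p ∈ τ.carrier) :
    τ.area = ∑ F ∈ faces τ, (a F - inner ℝ (ν F) p) / (m + 1) * F.area := by
  classical
  -- Faces through `p` are set aside: the cone formula needs a positive height, and their terms in
  -- the sum are zero.
  set S := (faces τ).filter fun F => inner ℝ (ν F) p < a F with hS
  have hSf : ∀ F ∈ S, F ∈ faces τ ∧ inner ℝ (ν F) p < a F := fun F hF => Finset.mem_filter.1 hF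
  have hpt : μHE[m + 1] ({p} : Set (Space N)) = 0 :=
    measure_eq_zero_of_finrank_lt (p := p) (D := ⊥) (by simp) (by simp)
  have hcover : μHE[m + 1] τ.carrier = μHE[m + 1] (⋃ F ∈ S, coneOver p F.carrier) := by
    apply le_antisymm
    · obtain ⟨H, hH⟩ := τ.isPolyhedral
      -- A constraint may touch `τ` in a set of dimension less than `m`, which is no face. The cones
      -- over these sets are null and do not disturb the covering.
      set E := H.filter fun h =>
        finrank ℝ (vectorSpan ℝ {y ∈ τ.carrier | inner ℝ h.1 y = h.2}) < m with hE
      have hsub : τ.carrier ⊆ (⋃ F ∈ S, coneOver p F.carrier) ∪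
          ({p} ∪ ⋃ h ∈ E, coneOver p {y ∈ τ.carrier | inner ℝ h.1 y = h.2}) := by
        intro x hx
        by_cases hxp : x = p
        · exact Or.inr (Or.inl hxp)
        obtain ⟨h, hh, hlt, hxc⟩ := exists_exit τ.isBounded hH hp hx hxp
        have hle : ∀ x ∈ τ.carrier, inner ℝ h.1 x ≤ h.2 := fun x hx => by
          rw [hH] at hx; exact hx h hh
        by_cases hfr : finrank ℝ (vectorSpan ℝ {y ∈ τ.carrier | inner ℝ h.1 y = h.2}) < m
        · exact Or.inr (Or.inr (Set.mem_biUnion (Finset.mem_filter.2 ⟨hh, hfr⟩) hxc))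
        left
        have hne : {y ∈ τ.carrier | inner ℝ h.1 y = h.2}.Nonempty := by
          obtain ⟨t, -, -, y, hy, -⟩ := mem_coneOver.1 hxc
          exact ⟨y, hy⟩
        -- The exit section omits `p`, which satisfies the constraint strictly, so its dimension is
        -- at most `m`. Since it is not less than `m`, the section is a facet.
        have hVlt : vectorSpan ℝ {y ∈ τ.carrier | inner ℝ h.1 y = h.2} <
            vectorSpan ℝ τ.carrier := by
          refine lt_of_le_of_ne (vectorSpan_mono ℝ fun x hx => hx.1) fun he => ?_
          obtain ⟨y, hy, hyc⟩ := hne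
          have := inner_eq_zero_of_mem_vectorSpan (n := h.1) (c := h.2) (fun x hx => hx.2)
            (he ▸ vsub_mem_vectorSpan ℝ hy hp)
          rw [vsub_eq_sub, inner_sub_right, hyc] at this
          linarith
        have hfl := Submodule.finrank_lt_finrank_of_lt hVlt
        rw [τ.finrank_vectorSpan] at hfl
        obtain ⟨F, hF, hFc⟩ := exists_isFace hle ⟨p, hp, hlt⟩ (by omega) hne
        have hFf := mem_faces.2 hF
        refine Set.mem_biUnion (x := F) (Finset.mem_filter.2 ⟨hFf, ?_⟩) (by rwa [hFc])
        refine lt_of_le_of_ne ((hν F hFf).2.2.1 p hp) fun he => ?_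
        have hpF : p ∈ F.carrier := by rw [(hν F hFf).2.2.2]; exact ⟨hp, he⟩
        rw [hFc] at hpF
        exact hlt.ne hpF.2
      refine (measure_mono hsub).trans ((measure_union_le _ _).trans ?_)
      rw [measure_union_null hpt, add_zero]
      exact (measure_biUnion_null_iff E.countable_toSet).2 fun h hh =>
        measure_coneOver_eq_zero (Finset.mem_filter.1 hh).2
    · refine measure_mono (Set.iUnion₂_subset fun F hF x hx => ?_)
      obtain ⟨t, ht0, ht1, y, hy, rfl⟩ := mem_coneOver.1 hx
      rw [(hν F (hSf F hF).1).2.2.2] at hy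
      exact τ.convex.add_smul_sub_mem hp hy.1 ⟨ht0, ht1⟩
  have hmeas : μHE[m + 1] τ.carrier = ∑ F ∈ S,
      ENNReal.ofReal ((a F - inner ℝ (ν F) p) / (m + 1)) * μHE[m] F.carrier := by
    rw [hcover, measure_biUnion_finset₀]
    · refine Finset.sum_congr rfl fun F hF => ?_
      obtain ⟨h1, h2, -, h4⟩ := hν F (hSf F hF).1
      refine measure_coneOver τ.finrank_vectorSpan h2 h1 (sub_pos.2 (hSf F hF).2) F.isCompact ?_ ?_
      · intro y hy
        rw [h4] at hy
        exact vsub_mem_vectorSpan ℝ hy.1 hp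
      · intro y hy
        rw [h4] at hy
        rw [inner_sub_right, hy.2]
    · intro F hF F' hF' hne
      obtain ⟨hFf, hFp⟩ := hSf F hF
      obtain ⟨hFf', hFp'⟩ := hSf F' hF'
      obtain ⟨-, -, h3, h4⟩ := hν F hFf
      obtain ⟨-, -, h3', h4'⟩ := hν F' hFf'
      have hsub := coneOver_inter_subset h3 h3' hFp hFp'
      rw [← h4, ← h4', Set.insert_eq] at hsub
      refine measure_mono_null hsub (measure_union_null hpt ?_)
      -- The empty intersection is treated apart because for `m = 0` its direction, of rank `0`,
      -- does not have rank less than `m`.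
      rcases (F.carrier ∩ F'.carrier).eq_empty_or_nonempty with he | hi
      · simp [he, coneOver]
      · exact measure_coneOver_eq_zero
          (finrank_vectorSpan_inter_lt (mem_faces.1 hFf) (mem_faces.1 hFf') hne hi)
    · exact fun F _ => (isCompact_coneOver p F.isCompact).isClosed.measurableSet.nullMeasurableSet
  have hpos : ∀ F ∈ faces τ, 0 ≤ (a F - inner ℝ (ν F) p) / (m + 1) := fun F hF =>
    div_nonneg (sub_nonneg.2 ((hν F hF).2.2.1 p hp)) (by positivity)
  rw [area, hmeas, ENNReal.toReal_sum fun F _ =>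
    ENNReal.mul_ne_top ENNReal.ofReal_ne_top F.measure_ne_top]
  rw [hS, Finset.sum_filter]
  refine Finset.sum_congr rfl fun F hF => ?_
  split_ifs with hlt
  · rw [ENNReal.toReal_mul, ENNReal.toReal_ofReal (hpos F hF), area]
  · rw [le_antisymm ((hν F hF).2.2.1 p hp) (not_lt.1 hlt), sub_self, zero_div, zero_mul]

/-- Minkowski's relation: the outer unit normals of the faces of a polyhedron, weighted by the
areas of the faces, add up to zero. -/
lemma sum_area_smul_normal (τ : OrientedPolyhedron N (m + 1)) {ν : OrientedPolyhedron N m → Space N}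
    {a : OrientedPolyhedron N m → ℝ}
    (hν : ∀ F ∈ faces τ, ‖ν F‖ = 1 ∧ ν F ∈ vectorSpan ℝ τ.carrier ∧
      (∀ x ∈ τ.carrier, inner ℝ (ν F) x ≤ a F) ∧
      F.carrier = {x ∈ τ.carrier | inner ℝ (ν F) x = a F}) :
    ∑ F ∈ faces τ, F.area • ν F = 0 := by
  set w := ∑ F ∈ faces τ, F.area • ν F with hw
  have hwV : w ∈ vectorSpan ℝ τ.carrier :=
    Submodule.sum_mem _ fun F hF => Submodule.smul_mem _ _ (hν F hF).2.1
  obtain ⟨q, hq⟩ := τ.nonempty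
  -- The normals and levels do not depend on the apex. Subtracting the volume formulas for the
  -- apices `p` and `q` leaves only `⟪w, p - q⟫ / (m + 1)`.
  have hconst : ∀ p ∈ τ.carrier, inner ℝ w p = inner ℝ w q := by
    intro p hp
    have h1 := area_eq_sum_faces τ hν hp
    rw [area_eq_sum_faces τ hν hq, ← sub_eq_zero, ← Finset.sum_sub_distrib] at h1
    have h2 : ∑ F ∈ faces τ, ((a F - inner ℝ (ν F) q) / (m + 1) * F.area -
        (a F - inner ℝ (ν F) p) / (m + 1) * F.area) =
        (inner ℝ w p - inner ℝ w q) / (m + 1) := by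
      rw [hw, sum_inner, sum_inner, ← Finset.sum_sub_distrib, Finset.sum_div]
      refine Finset.sum_congr rfl fun F _ => ?_
      rw [real_inner_smul_left, real_inner_smul_left]
      ring
    rw [h2, div_eq_zero_iff] at h1
    exact sub_eq_zero.1 (h1.resolve_right (by positivity))
  -- `w` is both in the direction of `τ` and orthogonal to it.
  exact inner_self_eq_zero.1 (inner_eq_zero_of_mem_vectorSpan hconst hwV)

/-! ### From normals to orientations by contraction. -/

-- Contraction obeys the signed product rule `(x ∧ v)⌞d = d(v) x - (x⌞d) ∧ v`. Peeling off the last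
-- factor, the first term vanishes by hypothesis and the second by induction.
open CliffordAlgebra in
lemma contractRight_ιMulti_eq_zero (d : Module.Dual ℝ (Space N)) :
    ∀ {m : ℕ} (b : Fin m → Space N), (∀ i, d (b i) = 0) →
      contractRight (ExteriorAlgebra.ιMulti ℝ m b) d = 0
  | 0, b, _ => by simp [ExteriorAlgebra.ιMulti_apply, contractRight_one]
  | m + 1, b, hb => by
    rw [ExteriorAlgebra.ιMulti_apply, List.ofFn_succ', List.concat_eq_append, List.prod_append,
      ← ExteriorAlgebra.ιMulti_apply]
    simp only [List.prod_cons, List.prod_nil, mul_one]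
    refine (contractRight_mul_ι _ _ _).trans ?_
    rw [contractRight_ιMulti_eq_zero d _ fun i => hb _, hb, zero_smul, zero_mul, sub_zero]

open CliffordAlgebra in
/-- The orientation of a face is the contraction of that of the polyhedron with the normal. -/
lemma contractRight_η {τ : OrientedPolyhedron N (m + 1)} {F : OrientedPolyhedron N m}
    {ν : Space N} {a : ℝ} (hν : ‖ν‖ = 1) (hF : ∀ x ∈ F.carrier, inner ℝ ν x = a)
    (hη : (τ.η : ExteriorAlgebra ℝ (Space N)) = F.η * ExteriorAlgebra.ι ℝ ν) :
    contractRight (τ.η : ExteriorAlgebra ℝ (Space N)) (innerₛₗ ℝ ν) =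
      (F.η : ExteriorAlgebra ℝ (Space N)) := by
  obtain ⟨b, -, h2, h3⟩ := F.isOrientation
  have hb : ∀ i, innerₛₗ ℝ ν (b i) = 0 := fun i => by
    simpa using inner_eq_zero_of_mem_vectorSpan hF (h2 ▸ Submodule.subset_span ⟨i, rfl⟩)
  -- `ν` is orthogonal to `F`, so in the product rule for `F.η ∧ ν` only `⟪ν, ν⟫ F.η = F.η`
  -- survives.
  have h0 : contractRight (F.η : ExteriorAlgebra ℝ (Space N)) (innerₛₗ ℝ ν) = 0 := by
    rcases h3 with h | h
    · rw [h, exteriorPower.ιMulti_apply_coe, contractRight_ιMulti_eq_zero _ _ hb]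
    · rw [h, NegMemClass.coe_neg, exteriorPower.ιMulti_apply_coe, map_neg, LinearMap.neg_apply,
        contractRight_ιMulti_eq_zero _ _ hb, neg_zero]
  rw [hη]
  refine (contractRight_mul_ι _ _ _).trans ?_
  rw [h0, zero_mul, sub_zero]
  simp [hν]

/-- Every `F.η` is the image of the normal of `F` under one and the same linear map, contraction of
`τ.η`. Applying this map to Minkowski's relation gives the claim. -/
lemma sum_area_smul_η (τ : OrientedPolyhedron N (m + 1)) : ∑ F ∈ faces τ, F.area • F.η = 0 := by
  have h : ∀ F : OrientedPolyhedron N m, ∃ (ν : Space N) (a : ℝ), F ∈ faces τ → ‖ν‖ = 1 ∧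
      ν ∈ vectorSpan ℝ τ.carrier ∧ (∀ x ∈ τ.carrier, inner ℝ ν x ≤ a) ∧
      F.carrier = {x ∈ τ.carrier | inner ℝ ν x = a} ∧
      (τ.η : ExteriorAlgebra ℝ (Space N)) = F.η * ExteriorAlgebra.ι ℝ ν := fun F => by
    by_cases hF : F ∈ faces τ
    · obtain ⟨ν, a, h⟩ := mem_faces.1 hF
      -- Off `faces τ` the values are irrelevant; zeros are used there to make the choice of normals
      -- and levels total.
      exact ⟨ν, a, fun _ => h⟩
    · exact ⟨0, 0, fun h => absurd h hF⟩
  choose ν a h using h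
  have hM := sum_area_smul_normal τ (ν := ν) (a := a) fun F hF =>
    ⟨(h F hF).1, (h F hF).2.1, (h F hF).2.2.1, (h F hF).2.2.2.1⟩
  apply Subtype.ext
  have hc : ∀ F ∈ faces τ, ((F.area • F.η : MVector N m) : ExteriorAlgebra ℝ (Space N)) =
      CliffordAlgebra.contractRight (τ.η : ExteriorAlgebra ℝ (Space N))
        (innerₛₗ ℝ (F.area • ν F)) := fun F hF => by
    obtain ⟨h1, -, -, h4, h5⟩ := h F hF
    rw [Submodule.coe_smul, ← contractRight_η h1 (fun x hx => by rw [h4] at hx; exact hx.2) h5]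
    simp
  rw [AddSubmonoidClass.coe_finsetSum, Finset.sum_congr rfl hc, ← map_sum, ← map_sum, hM]
  simp

/-! ### The homomorphism `Φ` on polyhedral chains. -/

lemma calibration_toChain (c : FormalChain N m (MVector N m)) :
    calibration N m (toChain c) = c.sum fun σ g => inner ℝ g σ.η * σ.area := by
  rw [calibration, chainLift_toChain, Finsupp.liftAddHom_apply]
  rfl

/-- By additivity a single `g[τ]` suffices. All faces carry the same coefficient `g`, which factors
out of the sum and leaves `sum_area_smul_η`. -/
lemma calibration_boundary (Q : PolyhedralChain N (m + 1) (MVector N m)) :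
    calibration N m (boundary Q) = 0 := by
  obtain ⟨c, rfl⟩ := toChain_surjective Q
  induction c using Finsupp.induction_linear with
  | zero => simp
  | add c d hc hd => simp [hc, hd]
  | single τ g =>
    have : boundary (toChain (Finsupp.single τ g)) = toChain (formalBoundary (Finsupp.single τ g)) :=
      rfl
    rw [this, formalBoundary_single, map_sum, map_sum]
    have hF : ∀ F : OrientedPolyhedron N m, calibration N m (toChain (Finsupp.single F g)) =
        inner ℝ g (F.area • F.η) := fun F => by
      rw [calibration_toChain, Finsupp.sum_single_index (by simp), mul_comm]
      exact (real_inner_smul_right g F.η F.area).symm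
    simp_rw [hF]
    rw [← inner_sum, sum_area_smul_η, inner_zero_right]

/-- Cauchy-Schwarz, term by term, with `‖σ.η‖ = 1`. Overlaps are harmless here, so any
representation whose weight is close to the mass yields `calibration_le_mass`. -/
lemma calibration_toChain_le_weight (c : FormalChain N m (MVector N m)) :
    calibration N m (toChain c) ≤ weight c := by
  rw [calibration_toChain]
  refine Finset.sum_le_sum fun σ _ => mul_le_mul_of_nonneg_right ?_ σ.area_nonneg
  have := real_inner_le_norm (c σ) σ.η
  rwa [σ.norm_η, mul_one] at this

lemma calibration_le_mass (A : PolyhedralChain N m (MVector N m)) :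
    calibration N m A ≤ mass A := by
  apply le_of_forall_pos_le_add
  intro ε hε
  obtain ⟨c, rfl, hc⟩ := exists_weight_lt A hε
  exact (calibration_toChain_le_weight c).trans hc.le

/-- Adding `∂Q` does not change `Φ`, so the mass bound for `A + ∂Q` bounds `Φ(A)` for every
competitor `Q`. -/
lemma calibration_le_flatNorm (A : PolyhedralChain N m (MVector N m)) :
    calibration N m A ≤ flatNorm A := by
  refine le_ciInf fun Q => ?_
  have := calibration_le_mass (A + boundary Q)
  rw [map_add, calibration_boundary, add_zero] at this
  linarith [mass_nonneg Q]

/-! ### Passage to flat chains. -/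

section FlatNorm

variable {G : Type*} [NormedAddCommGroup G]

lemma flatNorm_le_mass (A : PolyhedralChain N m G) : flatNorm A ≤ mass A := by
  simpa [mass_zero] using flatNorm_le A 0

/-- Along a sequence of polyhedral chains converging to `A`, the flat norms converge to `‖A‖` and
are bounded termwise by the masses, hence `‖A‖` is at most the lower limit of the masses. -/
lemma norm_le_flatMass (A : FlatChain N m G) : ENNReal.ofReal ‖A‖ ≤ flatMass A := by
  refine le_iInf₂ fun P hP => ?_
  have hlim : Filter.Tendsto (fun i => ENNReal.ofReal ‖(P i : FlatChain N m G)‖) Filter.atTop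
      (nhds (ENNReal.ofReal ‖A‖)) :=
    (ENNReal.continuous_ofReal.tendsto _).comp hP.norm
  rw [← hlim.liminf_eq]
  refine Filter.liminf_le_liminf (Filter.Eventually.of_forall fun i => ?_)
  rw [UniformSpace.Completion.norm_coe]
  exact ENNReal.ofReal_le_ofReal (flatNorm_le_mass (P i))

end FlatNorm

/-- The homomorphism `Φ` is bounded with respect to the flat norm. -/
noncomputable def calibrationHom (N m : ℕ) :
    NormedAddGroupHom (PolyhedralChain N m (MVector N m)) ℝ :=
  AddMonoidHom.mkNormedAddGroupHom (calibration N m) 1 fun A => by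
    -- The one-sided bound, applied to `A` and to `-A`, gives `|Φ(A)| ≤ ℱ(A)`, so the Lipschitz
    -- constant is `1`.
    rw [one_mul, Real.norm_eq_abs, abs_le']
    refine ⟨calibration_le_flatNorm A, ?_⟩
    rw [← map_neg, ← norm_neg]
    exact calibration_le_flatNorm (-A)

/-- The inequality is a closed condition and holds on the dense image of the polyhedral chains. -/
lemma calibrationHom_extension_le (A : FlatChain N m (MVector N m)) :
    (calibrationHom N m).extension A ≤ ‖A‖ := by
  induction A using UniformSpace.Completion.induction_on with
  | hp => exact isClosed_le (calibrationHom N m).extension.continuous continuous_norm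
  | ih A =>
    rw [NormedAddGroupHom.extension_coe, UniformSpace.Completion.norm_coe]
    exact calibration_le_flatNorm A

end FlatChains

theorem mainTheorem6 (N m : ℕ) :
    -- `Φ` is the homomorphism given by the formula
    (∀ c : FlatChains.FormalChain N m (FlatChains.MVector N m),
      FlatChains.calibration N m (FlatChains.toChain c) =
        c.sum fun σ g => inner ℝ g σ.η * σ.area) ∧
    -- `Φ` vanishes on boundaries
    (∀ Q : FlatChains.PolyhedralChain N (m + 1) (FlatChains.MVector N m),
      FlatChains.calibration N m (FlatChains.boundary Q) = 0) ∧
    -- `Φ ≤ ℱ ≤ M` on polyhedral chains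
    (∀ A : FlatChains.PolyhedralChain N m (FlatChains.MVector N m),
      FlatChains.calibration N m A ≤ FlatChains.flatNorm A ∧
        FlatChains.flatNorm A ≤ FlatChains.mass A) ∧
    -- `Φ` extends continuously to flat chains, with the same inequalities
    ∃ Φ : FlatChains.FlatChain N m (FlatChains.MVector N m) →+ ℝ,
      Continuous Φ ∧
      (∀ A : FlatChains.PolyhedralChain N m (FlatChains.MVector N m),
        Φ (A : FlatChains.FlatChain N m (FlatChains.MVector N m)) =
          FlatChains.calibration N m A) ∧
      ∀ A : FlatChains.FlatChain N m (FlatChains.MVector N m),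
        Φ A ≤ ‖A‖ ∧ ENNReal.ofReal ‖A‖ ≤ FlatChains.flatMass A := by
  refine ⟨FlatChains.calibration_toChain, FlatChains.calibration_boundary, fun A =>
    ⟨FlatChains.calibration_le_flatNorm A, FlatChains.flatNorm_le_mass A⟩,
    (FlatChains.calibrationHom N m).extension.toAddMonoidHom,
    (FlatChains.calibrationHom N m).extension.continuous,
    fun A => (FlatChains.calibrationHom N m).extension_coe A, fun A =>
    ⟨FlatChains.calibrationHom_extension_le A, FlatChains.norm_le_flatMass A⟩⟩
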